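/- **Setting.** Let $Y$ be a scalar outcome, $X\in\mathbb R^d$ covariates and $Z$ auxiliary variables with values in a measurable space, and let $\psi(y,x;\theta)\in\mathbb R^q$, $\theta\in\mathbb R^q$, be an estimating function, measurable in $(y,x)$. Let $\hat f$ be a fixed (independently trained) measurable real-valued prediction function of $Z$, $\omega\in\mathbb R^q$ a fixed weighting vector and $\Theta\subseteq\mathbb R^q$ a parameter space. One observes labeled data $(Y_i,X_i,Z_i)$, $1\le i\le n$, and unlabeled data $(X_i,Z_i)$, $n+1\le i\le n+N$, where $n\to\infty$ and $N\to\infty$ along some sequence of sample sizes. The PSPA estimator $\hat\theta_{\rm PSPA}(\omega)$ is a random vector that solves in $\Theta$ the equation $$\Psi^{\omega}(\theta):=\frac1n\sum_{i=1}^n\psi(Y_i,X_i;\theta)+\operatorname{diag}(\omega)\Big\{-\frac1n\sum_{i=1}^n\psi(\hat f(Z_i),X_i;\theta)+\frac1N\sum_{i=n+1}^{n+N}\psi(\hat f(Z_i),X_i;\theta)\Big\}=0$$ whenever this equation has a unique solution in $\Theta$. **Conditions.** - (C1) $\Theta$ is compact and contains $\theta_0$, which is the unique solution in $\Theta$ of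 $\mathbb E\,\psi(Y,X;\theta)=0$. - (C2) Almost surely, the terms $\psi(Y,X;\theta)$ and $\operatorname{diag}(\omega)\psi(\hat f(Z),X;\theta)$ of $\Psi^\omega$ are continuous in $\theta\in\Theta$; and, with probability tending to one, $\Psi^\omega(\theta)=0$ has a unique solution in $\Theta$. - (C3) $\sup_{\theta\in\Theta}\mathbb E\|\psi(Y,X;\theta)\|^2<\infty$ and $\sup_{\theta\in\Theta}\mathbb E\|\operatorname{diag}(\omega)\psi(\hat f(Z),X;\theta)\|^2<\infty$; moreover there is an integrable function $h$ of $(Y,X,Z)$ such that almost surely $\|\psi(Y,X;\theta)\|\le h$ and $\|\operatorname{diag}(\omega)\psi(\hat f(Z),X;\theta)\|\le h$ for all $\theta\in\Theta$. - (C4) The labeled data are i.i.d. copies of $(Y,X,Z)$, the unlabeled data are i.i.d. copies of $(X,Z)$, and the two samples are independent. - (C5) There are a function $\varphi$ of $(Y,X,Z)$ with $\mathbb E\varphi^2<\infty$ and a neighborhood of $\theta_0$ such that, almost surely, $\|\psi(Y,X;\theta')-\psi(Y,X;\theta'')\|\le\varphi\,\|\theta'-\theta''\|$ and $\|\operatorname{diag}(\omega)\{\psi(\hat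 f(Z),X;\theta')-\psi(\hat f(Z),X;\theta'')\}\|\le\varphi\,\|\theta'-\theta''\|$ for all $\theta',\theta''$ in that neighborhood. Furthermore $\theta\mapsto\mathbb E\,\psi(Y,X;\theta)$ is differentiable at $\theta_0$ with a nonsingular derivative matrix $A$. **Theorem.** Under (C1)–(C4), $\hat\theta_{\rm PSPA}(\omega)\to\theta_0$ in probability. If in addition $n/N\to\rho\in[0,\infty)$ and (C5) holds, then $$\sqrt n\,\big(\hat\theta_{\rm PSPA}(\omega)-\theta_0\big)\ \xrightarrow{d}\ \mathcal N\big(0,\ A^{-1}V(\omega)(A^{-1})^{\mathsf T}\big),$$ $$V(\omega)=M_1+\operatorname{diag}(\omega)(M_2+\rho M_3)\operatorname{diag}(\omega)-\big\{M_4\operatorname{diag}(\omega)+\operatorname{diag}(\omega)M_4^{\mathsf T}\big\},$$ where $M_1=\operatorname{Var}[\psi(Y,X;\theta_0)]$, $M_2=\operatorname{Var}[\psi(\hat f(Z),X;\theta_0)]$ in the labeled population, $M_3=\operatorname{Var}[\psi(\hat f(Z),X;\theta_0)]$ in the unlabeled population and $M_4=\operatorname{Cov}[\psi(Y,X;\theta_0),\psi(\hat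 f(Z),X;\theta_0)]$; the matrix $A^{-1}V(\omega)(A^{-1})^{\mathsf T}$ is positive semidefinite. (Entries of $M_2,M_3,M_4$ that are multiplied by a vanishing component of $\omega$ are disregarded.) If moreover $\psi(Y,X;\cdot)$ is almost surely differentiable at $\theta_0$, then $\partial\psi(Y,X;\theta_0)/\partial\theta$ is integrable and $A=\mathbb E[\partial\psi(Y,X;\theta_0)/\partial\theta]$. (If $A$ and $\operatorname{diag}(\omega)M_4^{\mathsf T}$ are symmetric, the asymptotic covariance is $A^{-1}V(\omega)A^{-1}$ with $V(\omega)=M_1+\operatorname{diag}(\omega)(M_2+\rho M_3)\operatorname{diag}(\omega)-2\operatorname{diag}(\omega)M_4^{\mathsf T}$.) -/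

import Mathlib

open MeasureTheory ProbabilityTheory Filter Topology
open scoped ENNReal

noncomputable section

namespace PSPA

/-- The Euclidean space `ℝ^m`. -/
abbrev Vec (m : ℕ) : Type := EuclideanSpace ℝ (Fin m)

/-- The product `diag(w) v`. -/
def diagMul {q : ℕ} (w : Fin q → ℝ) (v : Vec q) : Vec q :=
  WithLp.toLp 2 (fun j => w j * v j)

section

variable {d q : ℕ} {𝒵 : Type*}

/-- The summand `ψ(Y, X; θ)` at a population point `(y, x, z)`. -/
def trueScore (ψ : ℝ → Vec d → Vec q → Vec q) (θ : Vec q) (w : ℝ × Vec d × 𝒵) : Vec q :=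
  ψ w.1 w.2.1 θ

/-- The summand `ψ(f(Z), X; θ)` at an unlabeled point `(x, z)`. -/
def predScore (ψ : ℝ → Vec d → Vec q → Vec q) (f : 𝒵 → ℝ) (θ : Vec q) (u : Vec d × 𝒵) : Vec q :=
  ψ (f u.2) u.1 θ

/-- The estimating function
`(1/n) ∑ ψ(yᵢ, xᵢ; θ) + diag(w) {-(1/n) ∑ ψ(f(zᵢ), xᵢ; θ) + (1/N) ∑ ψ(f(z'ⱼ), x'ⱼ; θ)}`
computed from the first `n` labeled points of `lab` and the first `N` unlabeled points of `unl`. -/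
def estFun (ψ : ℝ → Vec d → Vec q → Vec q) (f : 𝒵 → ℝ) (w : Fin q → ℝ) (n N : ℕ)
    (lab : ℕ → ℝ × Vec d × 𝒵) (unl : ℕ → Vec d × 𝒵) (θ : Vec q) : Vec q :=
  (n : ℝ)⁻¹ • ∑ i ∈ Finset.range n, trueScore ψ θ (lab i) +
    diagMul w (-((n : ℝ)⁻¹ • ∑ i ∈ Finset.range n, predScore ψ f θ (lab i).2) +
      (N : ℝ)⁻¹ • ∑ j ∈ Finset.range N, predScore ψ f θ (unl j))

/-- `θ` is a solution of the estimating equation in the parameter space. -/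
def IsSolution (ψ : ℝ → Vec d → Vec q → Vec q) (f : 𝒵 → ℝ) (w : Fin q → ℝ) (Θ : Set (Vec q))
    (n N : ℕ) (lab : ℕ → ℝ × Vec d × 𝒵) (unl : ℕ → Vec d × 𝒵) (θ : Vec q) : Prop :=
  θ ∈ Θ ∧ estFun ψ f w n N lab unl θ = 0

variable [MeasurableSpace 𝒵]

/-- (C1): compact parameter space; `θ₀` is the unique solution of `E ψ(Y, X; θ) = 0` in it. -/
structure CondC1 (ψ : ℝ → Vec d → Vec q → Vec q) (π : Measure (ℝ × Vec d × 𝒵))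
    (Θ : Set (Vec q)) (θ₀ : Vec q) : Prop where
  compact : IsCompact Θ
  mem : θ₀ ∈ Θ
  solves : ∫ w, trueScore ψ θ₀ w ∂π = 0
  unique : ∀ θ ∈ Θ, ∫ w, trueScore ψ θ w ∂π = 0 → θ = θ₀

/-- (C2): the terms of the estimating function are almost surely continuous in `θ ∈ Θ`, and
the estimating equation has a unique solution in `Θ`, with probability tending to one. -/
structure CondC2 {Ω : Type*} [MeasurableSpace Ω] (P : Measure Ω)
    (ψ : ℝ → Vec d → Vec q → Vec q) (f : 𝒵 → ℝ) (w : Fin q → ℝ)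
    (π : Measure (ℝ × Vec d × 𝒵)) (Θ : Set (Vec q)) (n N : ℕ → ℕ)
    (L : ℕ → Ω → ℝ × Vec d × 𝒵) (U : ℕ → Ω → Vec d × 𝒵) : Prop where
  continuous_true : ∀ᵐ p ∂π, ContinuousOn (fun θ => trueScore ψ θ p) Θ
  continuous_pred : ∀ᵐ p ∂π, ContinuousOn (fun θ => diagMul w (predScore ψ f θ p.2)) Θ
  unique_solution : Tendsto
    (fun k => P {a | ¬ ∃! θ, IsSolution ψ f w Θ (n k) (N k) (fun i => L i a) (fun j => U j a) θ})
    atTop (𝓝 0)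

/-- (C3): uniformly bounded second moments, and an integrable envelope. -/
structure CondC3 (ψ : ℝ → Vec d → Vec q → Vec q) (f : 𝒵 → ℝ) (w : Fin q → ℝ)
    (π : Measure (ℝ × Vec d × 𝒵)) (Θ : Set (Vec q)) : Prop where
  moment_true : ⨆ θ ∈ Θ, ∫⁻ p, ‖trueScore ψ θ p‖ₑ ^ 2 ∂π < ∞
  moment_pred : ⨆ θ ∈ Θ, ∫⁻ p, ‖diagMul w (predScore ψ f θ p.2)‖ₑ ^ 2 ∂π < ∞
  envelope : ∃ h : ℝ × Vec d × 𝒵 → ℝ, Integrable h π ∧ ∀ᵐ p ∂π, ∀ θ ∈ Θ,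
    ‖trueScore ψ θ p‖ ≤ h p ∧ ‖diagMul w (predScore ψ f θ p.2)‖ ≤ h p

/-- (C4): the labeled points `L i = (Yᵢ, Xᵢ, Zᵢ)` are i.i.d. with law `π`, the unlabeled points
`U j = (X'ⱼ, Z'ⱼ)` are i.i.d. with the law of `(X, Z)` under `π`, and the two are independent. -/
structure CondC4 {Ω : Type*} [MeasurableSpace Ω] (P : Measure Ω)
    (π : Measure (ℝ × Vec d × 𝒵))
    (L : ℕ → Ω → ℝ × Vec d × 𝒵) (U : ℕ → Ω → Vec d × 𝒵) : Prop where
  measurable_labeled : ∀ i, Measurable (L i)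
  measurable_unlabeled : ∀ j, Measurable (U j)
  law_labeled : ∀ i, P.map (L i) = π
  law_unlabeled : ∀ j, P.map (U j) = π.snd
  indep_labeled : iIndepFun L P
  indep_unlabeled : iIndepFun U P
  indep : IndepFun (fun a i => L i a) (fun a j => U j a) P

/-- (C5): near `θ₀` the estimating functions are Lipschitz in `θ`, with a square integrable
Lipschitz factor, and `θ ↦ E ψ(Y, X; θ)` is differentiable at `θ₀` with nonsingular derivative
matrix `A`. -/
structure CondC5 (ψ : ℝ → Vec d → Vec q → Vec q) (f : 𝒵 → ℝ) (w : Fin q → ℝ)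
    (π : Measure (ℝ × Vec d × 𝒵)) (θ₀ : Vec q) (A : Matrix (Fin q) (Fin q) ℝ) : Prop where
  lipschitz : ∃ φ : ℝ × Vec d × 𝒵 → ℝ, MemLp φ 2 π ∧ ∃ r > 0, ∀ᵐ p ∂π,
    ∀ θ' ∈ Metric.ball θ₀ r, ∀ θ'' ∈ Metric.ball θ₀ r,
      ‖trueScore ψ θ' p - trueScore ψ θ'' p‖ ≤ φ p * ‖θ' - θ''‖ ∧
      ‖diagMul w (predScore ψ f θ' p.2 - predScore ψ f θ'' p.2)‖ ≤ φ p * ‖θ' - θ''‖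
  differentiable : HasFDerivAt (fun θ => ∫ p, trueScore ψ θ p ∂π)
    (Matrix.toEuclideanCLM (n := Fin q) (𝕜 := ℝ) A) θ₀
  nonsingular : IsUnit A.det

/-- `M₁ = Var[ψ(Y, X; θ)]`. -/
def M₁ (ψ : ℝ → Vec d → Vec q → Vec q) (π : Measure (ℝ × Vec d × 𝒵)) (θ : Vec q) :
    Matrix (Fin q) (Fin q) ℝ :=
  Matrix.of fun j k => cov[fun p => trueScore ψ θ p j, fun p => trueScore ψ θ p k; π]

/-- `M₂ = Var[ψ(f(Z), X; θ)]` under the labeled population. -/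
def M₂ (ψ : ℝ → Vec d → Vec q → Vec q) (f : 𝒵 → ℝ) (π : Measure (ℝ × Vec d × 𝒵)) (θ : Vec q) :
    Matrix (Fin q) (Fin q) ℝ :=
  Matrix.of fun j k => cov[fun p => predScore ψ f θ p.2 j, fun p => predScore ψ f θ p.2 k; π]

/-- `M₃ = Var[ψ(f(Z), X; θ)]` under the unlabeled population. -/
def M₃ (ψ : ℝ → Vec d → Vec q → Vec q) (f : 𝒵 → ℝ) (π : Measure (ℝ × Vec d × 𝒵)) (θ : Vec q) :
    Matrix (Fin q) (Fin q) ℝ :=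
  Matrix.of fun j k => cov[fun u => predScore ψ f θ u j, fun u => predScore ψ f θ u k; π.snd]

/-- `M₄ = Cov[ψ(Y, X; θ), ψ(f(Z), X; θ)]`. -/
def M₄ (ψ : ℝ → Vec d → Vec q → Vec q) (f : 𝒵 → ℝ) (π : Measure (ℝ × Vec d × 𝒵)) (θ : Vec q) :
    Matrix (Fin q) (Fin q) ℝ :=
  Matrix.of fun j k => cov[fun p => trueScore ψ θ p j, fun p => predScore ψ f θ p.2 k; π]

/-- `V(w) = M₁ + diag(w) (M₂ + ρ M₃) diag(w) - (M₄ diag(w) + diag(w) M₄ᵀ)`. -/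
def V (ψ : ℝ → Vec d → Vec q → Vec q) (f : 𝒵 → ℝ) (w : Fin q → ℝ)
    (π : Measure (ℝ × Vec d × 𝒵)) (θ : Vec q) (ρ : ℝ) : Matrix (Fin q) (Fin q) ℝ :=
  M₁ ψ π θ + Matrix.diagonal w * (M₂ ψ f π θ + ρ • M₃ ψ f π θ) * Matrix.diagonal w
    - (M₄ ψ f π θ * Matrix.diagonal w + Matrix.diagonal w * (M₄ ψ f π θ).transpose)

/-- The asymptotic covariance matrix `A⁻¹ V(w) (A⁻¹)ᵀ`. -/
def asympCov (ψ : ℝ → Vec d → Vec q → Vec q) (f : 𝒵 → ℝ) (w : Fin q → ℝ)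
    (π : Measure (ℝ × Vec d × 𝒵)) (θ : Vec q) (ρ : ℝ) (A : Matrix (Fin q) (Fin q) ℝ) :
    Matrix (Fin q) (Fin q) ℝ :=
  A⁻¹ * V ψ f w π θ ρ * A⁻¹.transpose

end

end PSPA

end

/-! Regroup `estFun` into an average of `labScore`, i.e. ψ(Y,X;θ) - diag(ω)ψ(f(Z),X;θ), over the
labeled sample and an average of `unlScore`, i.e. diag(ω)ψ(f(Z),X;θ), over the independent unlabeled
sample. Since (X,Z) has the same law in both, the prediction terms cancel in the mean and the centre
is m(θ) = E ψ(Y,X;θ) for every ω. The estimator is thus a Z-estimator for m.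

Consistency: both averages converge uniformly on the compact Θ (`uniform_law_of_large_numbers`, a
strong law in the Banach space of continuous functions), and compactness makes the zero θ₀ of m well
separated (`tendstoInMeasure_of_uniform`).

Normality: let W be the labeled empirical process at θ₀ plus √(n/N) times the unlabeled one. The
Lipschitz condition and `chaining` show that the expected oscillation of the empirical processes
over a δ-ball is at most Cδ, uniformly in the sample size (`stochastic_equicontinuity`). Hence
√n(Ψ(θ) - m(θ)) is close to W near θ₀. Inserting Ψ(θ̂) = 0 and linearising m gives √n(θ̂ - θ₀) =
-A⁻¹W + o_P(1) (`asymptotic_linearity`). Independence of the samples turns the central limit theorem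
for W into a product of characteristic functions (`tendstoInDistribution_empProc_add`). The limiting
variance in direction t is Var⟨t, labScore⟩ + ρ Var⟨t, unlScore⟩, which is the quadratic form of V
(`dotProduct_V_mulVec`) and shows that V is positive semidefinite.

Suprema over θ need not be measurable, so bounds on them are stated through a majorant D valid
almost surely for all θ at once. -/

noncomputable section

open scoped RealInnerProductSpace

namespace PSPA

/-! ### Transfer of almost sure bounds from the law of (Y,X,Z) to that of (X,Z) -/

/-- A property that holds almost surely for a pair with real first component holds, for almost
every value of the second component, at some value of the first one; this value can be chosen such
that a given nonnegative function is bounded by a function of the second component alone that has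
the same mean. -/
lemma exists_snd_majorant {𝒰 : Type*} [MeasurableSpace 𝒰] (π : Measure (ℝ × 𝒰))
    [IsProbabilityMeasure π] {F : ℝ × 𝒰 → ℝ≥0∞} (hF : Measurable F) :
    ∃ F' : 𝒰 → ℝ≥0∞, Measurable F' ∧ ∫⁻ u, F' u ∂π.snd = ∫⁻ p, F p ∂π ∧
      ∀ R : ℝ × 𝒰 → Prop, (∀ᵐ p ∂π, R p) → ∀ᵐ u ∂π.snd, ∃ y, R (y, u) ∧ F (y, u) ≤ F' u := by
  -- The components are swapped because `condKernel` conditions on the first one; the remaining one,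
  -- real-valued, is standard Borel, so no assumption on `𝒰` is needed.
  set τ : Measure (𝒰 × ℝ) := π.map Prod.swap with hτ
  have hprob : IsProbabilityMeasure τ :=
    Measure.isProbabilityMeasure_map measurable_swap.aemeasurable
  have hfst : τ.fst = π.snd := Measure.fst_map_swap
  have hdis : π.snd ⊗ₘ τ.condKernel = τ := by rw [← hfst]; exact τ.disintegrate _
  have hG : Measurable fun p : 𝒰 × ℝ => F p.swap := hF.comp measurable_swap
  have hswap : τ.map Prod.swap = π := by
    rw [hτ, Measure.map_map measurable_swap measurable_swap]
    simp
  -- The majorant is the conditional mean of `F` given the second component.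
  refine ⟨fun u => ∫⁻ y, F (y, u) ∂(τ.condKernel u), ?_, ?_, ?_⟩
  · exact Measurable.lintegral_kernel_prod_right hG
  · calc _ = ∫⁻ p : 𝒰 × ℝ, F p.swap ∂τ := by
          conv_rhs => rw [← hdis, Measure.lintegral_compProd hG]
          rfl
      _ = _ := by conv_rhs => rw [← hswap, lintegral_map hF measurable_swap]
  · intro R hR
    have h1 : ∀ᵐ p ∂τ, R p.swap := by
      rw [← hswap] at hR
      exact ae_of_ae_map measurable_swap.aemeasurable hR
    rw [← hdis] at h1
    filter_upwards [Measure.ae_ae_of_ae_compProd h1] with u hu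
    -- A function is at most its mean on a set of positive probability, which must meet the
    -- full-measure set where `R` holds.
    have hpos := measure_le_lintegral_pos (μ := τ.condKernel u) (f := fun y => F (y, u))
      (hF.comp measurable_prodMk_right).aemeasurable
    obtain ⟨y, hy1, hy2⟩ := (((frequently_ae_iff (μ := τ.condKernel u)
      (p := fun y => F (y, u) ≤ ∫⁻ y, F (y, u) ∂(τ.condKernel u))).2 hpos.ne').and_eventually
        hu).exists
    exact ⟨y, hy2, hy1⟩

/-- Not immediate from the definition of a pushforward, because `R` may fail to be measurable (it
quantifies over uncountably many θ in the applications). -/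
lemma ae_snd_of_ae {𝒰 : Type*} [MeasurableSpace 𝒰] {π : Measure (ℝ × 𝒰)}
    [IsProbabilityMeasure π] {R : 𝒰 → Prop} (h : ∀ᵐ p ∂π, R p.2) : ∀ᵐ u ∂π.snd, R u := by
  obtain ⟨F', -, -, hF'⟩ := exists_snd_majorant π (F := 0) measurable_zero
  filter_upwards [hF' (fun p => R p.2) h] with u hu
  exact hu.choose_spec.1

/-! ### Uniform law of large numbers -/

/-- By second countability every open set is a countable union of balls, whose preimages are
sublevel sets of distances. -/
lemma measurable_of_measurable_dist {𝒳 M : Type*} [MeasurableSpace 𝒳] [PseudoMetricSpace M]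
    [SecondCountableTopology M] [MeasurableSpace M] [BorelSpace M] {F : 𝒳 → M}
    (h : ∀ c, Measurable fun x => dist (F x) c) : Measurable F := by
  refine measurable_of_isOpen fun V hV => ?_
  choose! r hr hrV using Metric.isOpen_iff.1 hV
  obtain ⟨T, hT, hTV⟩ := TopologicalSpace.isOpen_iUnion_countable
    (fun c : V => Metric.ball (c : M) (r c)) fun c => Metric.isOpen_ball
  have hV' : V = ⋃ c ∈ T, Metric.ball (c : M) (r c) := by
    rw [hTV]
    refine Set.Subset.antisymm (fun c hc => ?_) (Set.iUnion_subset fun c => hrV c c.2)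
    exact Set.mem_iUnion.2 ⟨⟨c, hc⟩, Metric.mem_ball_self (hr c hc)⟩
  rw [hV', Set.preimage_iUnion₂]
  exact MeasurableSet.biUnion hT fun c _ => measurableSet_lt (h c) measurable_const

/-- The uniform distance between continuous maps is determined on a countable dense set. This makes
a random path a random element of `C(K, E)`. -/
lemma measurable_continuousMap_of_eval {𝒳 K E : Type*} [MeasurableSpace 𝒳] [MetricSpace K]
    [CompactSpace K] [NormedAddCommGroup E] [SecondCountableTopology E] [MeasurableSpace E]
    [BorelSpace E] [MeasurableSpace C(K, E)] [BorelSpace C(K, E)] {F : 𝒳 → C(K, E)}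
    (h : ∀ t, Measurable fun x => F x t) : Measurable F := by
  refine measurable_of_measurable_dist fun c => measurable_of_Iic fun r => ?_
  obtain ⟨D, hDc, hD⟩ := TopologicalSpace.exists_countable_dense K
  rcases lt_or_ge r 0 with hr | hr
  · convert! MeasurableSet.empty (α := 𝒳)
    ext x
    simpa using hr.trans_le dist_nonneg
  · have : (fun x => dist (F x) c) ⁻¹' Set.Iic r = ⋂ t ∈ D, {x | dist (F x t) (c t) ≤ r} := by
      ext x
      simp only [Set.mem_preimage, Set.mem_Iic, Set.mem_iInter, ContinuousMap.dist_le hr]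
      refine ⟨fun H t _ => H t, fun H t => ?_⟩
      have hcl : IsClosed {t | dist (F x t) (c t) ≤ r} := isClosed_le (by fun_prop) (by fun_prop)
      exact hcl.closure_subset_iff.2 (fun t ht => H t ht) (hD t)
    rw [this]
    exact MeasurableSet.biInter hDc fun t _ =>
      measurableSet_le ((h t).dist measurable_const) measurable_const

/-- The **uniform law of large numbers** over a compact parameter set, for summands that are almost
surely continuous in the parameter and have an integrable envelope. -/
theorem uniform_law_of_large_numbers {Ω 𝒳 T E : Type*} [MeasurableSpace Ω] [MeasurableSpace 𝒳]
    [MetricSpace T] [NormedAddCommGroup E] [NormedSpace ℝ E] [CompleteSpace E]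
    [SecondCountableTopology E] [MeasurableSpace E] [BorelSpace E]
    {P : Measure Ω} [IsProbabilityMeasure P] {μ : Measure 𝒳} {X : ℕ → Ω → 𝒳}
    (hX : ∀ i, Measurable (X i)) (hlaw : ∀ i, P.map (X i) = μ) (hindep : iIndepFun X P)
    {K : Set T} (hK : IsCompact K) {g : T → 𝒳 → E} (hg : ∀ t, Measurable (g t))
    (hcont : ∀ᵐ x ∂μ, ContinuousOn (fun t => g t x) K)
    {h : 𝒳 → ℝ} (hh : Integrable h μ) (hgh : ∀ᵐ x ∂μ, ∀ t ∈ K, ‖g t x‖ ≤ h x) :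
    ∃ D : ℕ → Ω → ℝ, TendstoInMeasure P D atTop (fun _ => 0) ∧
      ∀ᵐ a ∂P, ∀ n : ℕ, ∀ t ∈ K,
        ‖(n : ℝ)⁻¹ • ∑ i ∈ Finset.range n, g t (X i a) - ∫ x, g t x ∂μ‖ ≤ D n a := by
  classical
  have : CompactSpace K := isCompact_iff_compactSpace.1 hK
  let _ : MeasurableSpace C(K, E) := borel _
  have : BorelSpace C(K, E) := ⟨rfl⟩
  -- A measurable set of full measure with continuous paths; off it the path is replaced by 0, so
  -- that `F` is defined everywhere and measurable.
  set S : Set 𝒳 := (toMeasurable μ {x | ¬ ContinuousOn (fun t => g t x) K})ᶜ with hS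
  have hSm : MeasurableSet S := (measurableSet_toMeasurable _ _).compl
  have hSc : ∀ x ∈ S, ContinuousOn (fun t => g t x) K := fun x hx => by
    by_contra H
    exact hx (subset_toMeasurable _ _ H)
  have hSae : ∀ᵐ x ∂μ, x ∈ S := by
    rw [ae_iff]
    simpa [hS, measure_toMeasurable] using ae_iff.1 hcont
  let F : 𝒳 → C(K, E) := fun x =>
    if hx : x ∈ S then ⟨fun t => g t x, (hSc x hx).domRestrict⟩ else 0
  have hF : ∀ x ∈ S, ∀ t : K, F x t = g t x := fun x hx t => by
    simp only [F, hx, dite_true]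
    rfl
  have hFm : Measurable F := by
    refine measurable_continuousMap_of_eval fun t => ?_
    have : (fun x => F x t) = S.indicator (g t) := by
      ext x
      by_cases hx : x ∈ S
      · rw [hF x hx, Set.indicator_of_mem hx]
      · simp [F, hx]
    rw [this]
    exact (hg t).indicator hSm
  have hFi : Integrable F μ := by
    refine ⟨hFm.aestronglyMeasurable,
      ContinuousMap.hasFiniteIntegral_of_bound _ h hh.2 ?_⟩
    filter_upwards [hSae, hgh] with x hx hxh t
    rw [hF x hx]
    exact hxh t t.2
  have hXm : ∀ i, AEMeasurable (X i) P := fun i => (hX i).aemeasurable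
  -- The strong law in the Banach space `C(K, E)`: norm convergence there is uniform convergence on
  -- `K`.
  have hlln := strong_law_ae (fun i a => F (X i a)) (μ := P)
    (by rw [← hlaw 0] at hFi; exact hFi.comp_measurable (hX 0))
    (fun i j hij => (hindep.indepFun hij).comp hFm hFm)
    (fun i => (IdentDistrib.mk (hXm i) (hXm 0) (by rw [hlaw, hlaw])).comp hFm)
  have hmean : ∫ a, F (X 0 a) ∂P = ∫ x, F x ∂μ := by
    rw [← hlaw 0, integral_map (hXm 0) hFm.aestronglyMeasurable]
  have heval : ∀ t : K, (∫ x, F x ∂μ) t = ∫ x, g t x ∂μ := fun t => by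
    rw [ContinuousMap.integral_apply hFi]
    refine integral_congr_ae ?_
    filter_upwards [hSae] with x hx using hF x hx t
  refine ⟨fun n a => ‖(n : ℝ)⁻¹ • ∑ i ∈ Finset.range n, F (X i a) - ∫ x, F x ∂μ‖, ?_, ?_⟩
  · refine tendstoInMeasure_of_tendsto_ae (fun n => ?_) ?_
    · have h1 : AEStronglyMeasurable (fun a => ∑ i ∈ Finset.range n, F (X i a)) P :=
        Finset.aestronglyMeasurable_fun_sum _ fun i _ =>
          (hFm.comp (hX i)).aestronglyMeasurable
      have h2 : AEStronglyMeasurable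
          (fun a => (n : ℝ)⁻¹ • ∑ i ∈ Finset.range n, F (X i a)) P := h1.fun_const_smul _
      have h3 : AEStronglyMeasurable
          (fun a => (n : ℝ)⁻¹ • ∑ i ∈ Finset.range n, F (X i a) - ∫ x, F x ∂μ) P :=
        h2.sub aestronglyMeasurable_const
      exact h3.norm
    · filter_upwards [hlln] with a ha
      rw [hmean] at ha
      exact tendsto_iff_norm_sub_tendsto_zero.1 ha
  · have hall : ∀ᵐ a ∂P, ∀ i, X i a ∈ S := by
      refine ae_all_iff.2 fun i => ?_
      rw [← hlaw i] at hSae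
      exact ae_of_ae_map (hXm i) hSae
    filter_upwards [hall] with a ha n t ht
    have := ContinuousMap.norm_coe_le_norm
      ((n : ℝ)⁻¹ • ∑ i ∈ Finset.range n, F (X i a) - ∫ x, F x ∂μ) ⟨t, ht⟩
    simpa [ContinuousMap.sum_apply, heval, hF _ (ha _)] using this

/-! ### The empirical process -/

/-- The empirical process `n^{-1/2} ∑ (u(Xᵢ) - ∫ u dμ)`. -/
def empProc {Ω 𝒳 E : Type*} [MeasurableSpace 𝒳] [NormedAddCommGroup E] [NormedSpace ℝ E]
    (μ : Measure 𝒳) (X : ℕ → Ω → 𝒳) (n : ℕ) (u : 𝒳 → E) (a : Ω) : E :=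
  (√(n : ℝ))⁻¹ • ∑ i ∈ Finset.range n, (u (X i a) - ∫ x, u x ∂μ)

section empProc

variable {Ω 𝒳 E : Type*} [MeasurableSpace 𝒳] [NormedAddCommGroup E] [NormedSpace ℝ E]
  {μ : Measure 𝒳} {X : ℕ → Ω → 𝒳} {n : ℕ}

lemma empProc_sub {u v : 𝒳 → E} (hu : Integrable u μ) (hv : Integrable v μ) (a : Ω) :
    empProc μ X n (fun x => u x - v x) a = empProc μ X n u a - empProc μ X n v a := by
  simp only [empProc, integral_sub hu hv, ← smul_sub, ← Finset.sum_sub_distrib]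
  congr 1
  exact Finset.sum_congr rfl fun i _ => by abel

lemma empProc_add {u v : 𝒳 → E} (hu : Integrable u μ) (hv : Integrable v μ) (a : Ω) :
    empProc μ X n (fun x => u x + v x) a = empProc μ X n u a + empProc μ X n v a := by
  simp only [empProc, integral_add hu hv, ← smul_add, ← Finset.sum_add_distrib]
  congr 1
  exact Finset.sum_congr rfl fun i _ => by abel

lemma empProc_const_smul (c : ℝ) (u : 𝒳 → E) (a : Ω) :
    empProc μ X n (fun x => c • u x) a = c • empProc μ X n u a := by
  simp only [empProc, integral_smul, ← smul_sub, ← Finset.smul_sum]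
  rw [smul_comm]

lemma empProc_clm [CompleteSpace E] {F : Type*} [NormedAddCommGroup F] [NormedSpace ℝ F]
    [CompleteSpace F] (A : E →L[ℝ] F) {u : 𝒳 → E} (hu : Integrable u μ) (a : Ω) :
    empProc μ X n (fun x => A (u x)) a = A (empProc μ X n u a) := by
  simp [empProc, A.integral_comp_comm hu]

variable [MeasurableSpace Ω] {P : Measure Ω}

lemma measurable_empProc [MeasurableSpace E] [BorelSpace E] [SecondCountableTopology E]
    (hX : ∀ i, Measurable (X i)) {u : 𝒳 → E} (hu : Measurable u) :
    Measurable (empProc μ X n u) := by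
  unfold empProc
  exact (Finset.measurable_fun_sum _ fun i _ => (hu.comp (hX i)).sub_const _).const_smul _

lemma ae_comp_of_law (hX : ∀ i, Measurable (X i)) (hlaw : ∀ i, P.map (X i) = μ)
    {R : 𝒳 → Prop} (h : ∀ᵐ x ∂μ, R x) : ∀ᵐ a ∂P, ∀ i, R (X i a) := by
  refine ae_all_iff.2 fun i => ?_
  rw [← hlaw i] at h
  exact ae_of_ae_map (hX i).aemeasurable h

end empProc

/-! ### Exponential moments of the empirical process -/

section expMoment

variable {Ω 𝒳 : Type*} [MeasurableSpace Ω] [MeasurableSpace 𝒳] {P : Measure Ω}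
  [IsProbabilityMeasure P] {μ : Measure 𝒳} [IsProbabilityMeasure μ] {X : ℕ → Ω → 𝒳}

/-- For |z| ≤ 1 one has exp z ≤ 1 + z + z². With z = t(u - E u) the linear term has mean zero and
the quadratic one at most t²v. -/
lemma integral_exp_centered_le {u : 𝒳 → ℝ} (hu : Measurable u) {b v t : ℝ}
    (hb : ∀ᵐ x ∂μ, |u x| ≤ b) (hv : ∫ x, u x ^ 2 ∂μ ≤ v) (ht : |t| * (2 * b) ≤ 1) :
    Integrable (fun x => Real.exp (t * (u x - ∫ x, u x ∂μ))) μ ∧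
      ∫ x, Real.exp (t * (u x - ∫ x, u x ∂μ)) ∂μ ≤ Real.exp (t ^ 2 * v) := by
  set m := ∫ x, u x ∂μ with hm
  have hui : Integrable u μ := Integrable.of_bound hu.aestronglyMeasurable b hb
  have hu2 : Integrable (fun x => u x ^ 2) μ := by
    refine Integrable.of_bound (hu.pow_const 2).aestronglyMeasurable (b ^ 2) ?_
    filter_upwards [hb] with x hx
    rw [Real.norm_eq_abs, abs_pow]
    gcongr
  have hmb : |m| ≤ b := by
    have := norm_integral_le_of_norm_le_const (μ := μ) (f := u) hb
    simpa using this
  have hz : ∀ᵐ x ∂μ, |t * (u x - m)| ≤ 1 := by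
    filter_upwards [hb] with x hx
    rw [abs_mul]
    refine le_trans ?_ ht
    gcongr
    exact (abs_sub _ _).trans (by linarith)
  have hle : ∀ᵐ x ∂μ, Real.exp (t * (u x - m)) ≤ 1 + t * (u x - m) + (t * (u x - m)) ^ 2 := by
    filter_upwards [hz] with x hx
    have := (abs_le.1 (Real.abs_exp_sub_one_sub_id_le hx)).2
    linarith
  have hei : Integrable (fun x => Real.exp (t * (u x - m))) μ := by
    refine Integrable.of_bound (by fun_prop) (Real.exp 1) ?_
    filter_upwards [hz] with x hx
    rw [Real.norm_eq_abs, Real.abs_exp]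
    exact Real.exp_le_exp.2 (abs_le.1 hx).2
  refine ⟨hei, ?_⟩
  have heq : (fun x => 1 + t * (u x - m) + (t * (u x - m)) ^ 2) = fun x =>
      (1 - t * m + t ^ 2 * m ^ 2) + (t - 2 * t ^ 2 * m) * u x + t ^ 2 * u x ^ 2 := by
    ext x; ring
  have hi1 : Integrable (fun x => (1 - t * m + t ^ 2 * m ^ 2) + (t - 2 * t ^ 2 * m) * u x) μ :=
    (integrable_const _).add (hui.const_mul _)
  have hi2 : Integrable (fun x => t ^ 2 * u x ^ 2) μ := hu2.const_mul _
  have hqi : Integrable (fun x => 1 + t * (u x - m) + (t * (u x - m)) ^ 2) μ := by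
    rw [heq]
    exact hi1.add hi2
  calc _ ≤ ∫ x, 1 + t * (u x - m) + (t * (u x - m)) ^ 2 ∂μ := integral_mono_ae hei hqi hle
    _ = 1 + t ^ 2 * (∫ x, u x ^ 2 ∂μ - m ^ 2) := by
      rw [heq, integral_add hi1 hi2, integral_add (integrable_const _) (hui.const_mul _), integral_const_mul,
        integral_const_mul, ← hm]
      simp
      ring
    _ ≤ 1 + t ^ 2 * v := by gcongr; nlinarith [sq_nonneg m]
    _ ≤ _ := by linarith [Real.add_one_le_exp (t ^ 2 * v)]

/-- A Bernstein-type bound, uniform in `n`. Each summand is taken at t = ±1/(2√n), the largest size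
that `integral_exp_centered_le` allows for b = √n, and contributes a factor at most exp(v/(4n)).
Adding both signs handles the absolute value and costs the factor 2. -/
lemma lintegral_exp_empProc_le (hX : ∀ i, Measurable (X i)) (hlaw : ∀ i, P.map (X i) = μ)
    (hindep : iIndepFun X P) {n : ℕ} (hn : 0 < n) {u : 𝒳 → ℝ} (hu : Measurable u)
    (hb : ∀ᵐ x ∂μ, |u x| ≤ √(n : ℝ)) {v : ℝ} (hv : ∫ x, u x ^ 2 ∂μ ≤ v) :
    ∫⁻ a, ENNReal.ofReal (Real.exp (|empProc μ X n u a| / 2)) ∂P ≤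
      ENNReal.ofReal (2 * Real.exp (v / 4)) := by
  have hn' : (0 : ℝ) < n := by exact_mod_cast hn
  have hs : 0 < √(n : ℝ) := Real.sqrt_pos.2 hn'
  have key : ∀ c : ℝ, |c| = 1 / 2 →
      Integrable (fun a => Real.exp (c * empProc μ X n u a)) P ∧
      ∫ a, Real.exp (c * empProc μ X n u a) ∂P ≤ Real.exp (v / 4) := by
    intro c hc
    set t := c * (√(n : ℝ))⁻¹ with ht
    have ht2 : t ^ 2 = (4 * n : ℝ)⁻¹ := by
      rw [ht, mul_pow, inv_pow, Real.sq_sqrt hn'.le, ← sq_abs, hc, mul_inv]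
      norm_num
    obtain ⟨h1, h2⟩ := integral_exp_centered_le (μ := μ) (t := t) hu hb hv (by
      rw [ht, abs_mul, hc, abs_of_pos (inv_pos.2 hs)]
      field_simp
      norm_num)
    set Y : ℕ → Ω → ℝ := fun i a => u (X i a) - ∫ x, u x ∂μ with hY
    have hYm : ∀ i, Measurable (Y i) := fun i => (hu.comp (hX i)).sub_const _
    have hYind : iIndepFun Y P :=
      hindep.comp (fun _ x => u x - ∫ x, u x ∂μ) fun _ => hu.sub_const _
    have hmgf : ∀ i, mgf (Y i) P t ≤ Real.exp (t ^ 2 * v) := fun i => by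
      refine le_of_eq_of_le ?_ h2
      rw [← hlaw i] at h1 ⊢
      rw [integral_map (hX i).aemeasurable h1.1]
      simp [mgf, hY, hlaw]
    have hexp : ∀ a, Real.exp (c * empProc μ X n u a) =
        Real.exp (t * (∑ i ∈ Finset.range n, Y i) a) := fun a => by
      simp only [empProc, smul_eq_mul, ht, hY, Finset.sum_apply, mul_assoc]
    have hint : ∀ i ∈ Finset.range n, Integrable (fun a => Real.exp (t * Y i a)) P :=
      fun i _ => by
        rw [← hlaw i] at h1
        have := h1.comp_measurable (hX i)
        simpa [hY, hlaw, Function.comp_def] using this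
    refine ⟨?_, ?_⟩
    · simp_rw [hexp]
      exact hYind.integrable_exp_mul_sum hYm hint
    · simp_rw [hexp]
      change mgf (∑ i ∈ Finset.range n, Y i) P t ≤ _
      rw [hYind.mgf_sum hYm]
      calc _ ≤ ∏ _i ∈ Finset.range n, Real.exp (t ^ 2 * v) :=
            Finset.prod_le_prod (fun i _ => mgf_nonneg) fun i _ => hmgf i
        _ = _ := by
            rw [Finset.prod_const, Finset.card_range, ← Real.exp_nat_mul, ht2]
            congr 1
            field_simp
  obtain ⟨hi1, hl1⟩ := key (1 / 2) (by norm_num)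
  obtain ⟨hi2, hl2⟩ := key (-(1 / 2)) (by norm_num)
  have hpt : ∀ a, Real.exp (|empProc μ X n u a| / 2) ≤
      Real.exp (1 / 2 * empProc μ X n u a) + Real.exp (-(1 / 2) * empProc μ X n u a) := by
    intro a
    rcases abs_cases (empProc μ X n u a) with ⟨h, -⟩ | ⟨h, -⟩ <;> rw [h]
    · rw [show empProc μ X n u a / 2 = 1 / 2 * empProc μ X n u a by ring]
      linarith [Real.exp_pos (-(1 / 2) * empProc μ X n u a)]
    · rw [show -empProc μ X n u a / 2 = -(1 / 2) * empProc μ X n u a by ring]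
      linarith [Real.exp_pos (1 / 2 * empProc μ X n u a)]
  calc _ ≤ ∫⁻ a, ENNReal.ofReal (Real.exp (1 / 2 * empProc μ X n u a) +
        Real.exp (-(1 / 2) * empProc μ X n u a)) ∂P :=
        lintegral_mono fun a => ENNReal.ofReal_le_ofReal (hpt a)
    _ = ENNReal.ofReal (∫ a, (Real.exp (1 / 2 * empProc μ X n u a) +
        Real.exp (-(1 / 2) * empProc μ X n u a)) ∂P) :=
        (ofReal_integral_eq_lintegral_ofReal (hi1.add hi2)
          (ae_of_all _ fun a => (add_pos (Real.exp_pos _) (Real.exp_pos _)).le)).symm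
    _ ≤ _ := by
        refine ENNReal.ofReal_le_ofReal ?_
        rw [integral_add hi1 hi2]
        linarith

end expMoment

/-! ### Chaining -/

section chaining

variable {T : Type*} [NormedAddCommGroup T] [NormedSpace ℝ T]

/-- Successive nets around a point, each obtained from the previous one by adding half-sized
copies of a fixed finite set. -/
def chainNet (S : Finset T) (t₀ : T) (δ : ℝ) : ℕ → Set T
  | 0 => {t₀}
  | k + 1 => Set.image2 (fun x s => x + (δ / 2 ^ k) • s) (chainNet S t₀ δ k) S

lemma chainNet_finite (S : Finset T) (t₀ : T) (δ : ℝ) (k : ℕ) : (chainNet S t₀ δ k).Finite := by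
  induction k with
  | zero => exact Set.finite_singleton _
  | succ k ih => exact ih.image2 _ S.finite_toSet

lemma ncard_chainNet_le (S : Finset T) (t₀ : T) (δ : ℝ) (k : ℕ) :
    (chainNet S t₀ δ k).ncard ≤ S.card ^ k := by
  induction k with
  | zero => simp [chainNet]
  | succ k ih =>
    rw [chainNet, ← Set.image_uncurry_prod, pow_succ]
    refine (Set.ncard_image_le ((chainNet_finite S t₀ δ k).prod S.finite_toSet)).trans ?_
    rw [Set.ncard_prod, Set.ncard_coe_finset]
    exact Nat.mul_le_mul_right _ ih

/-- The steps δ, δ/2, δ/4, … form a geometric series. All nets stay in the ball of radius 2δ, which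
is why later hypotheses are imposed on that ball. -/
lemma norm_sub_le_of_mem_chainNet {S : Finset T} (hS : ∀ s ∈ S, ‖s‖ ≤ 1) {t₀ : T} {δ : ℝ}
    (hδ : 0 < δ) {k : ℕ} {x : T} (hx : x ∈ chainNet S t₀ δ k) :
    ‖x - t₀‖ ≤ 2 * δ - 2 * (δ / 2 ^ k) := by
  induction k generalizing x with
  | zero =>
    rw [chainNet, Set.mem_singleton_iff] at hx
    simp [hx]
  | succ k ih =>
    obtain ⟨y, hy, s, hs, rfl⟩ := hx
    have h1 : ‖(δ / 2 ^ k) • s‖ ≤ δ / 2 ^ k := by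
      rw [norm_smul, Real.norm_of_nonneg (by positivity)]
      exact mul_le_of_le_one_right (by positivity) (hS s hs)
    calc ‖y + (δ / 2 ^ k) • s - t₀‖ = ‖(y - t₀) + (δ / 2 ^ k) • s‖ := by congr 1; abel
      _ ≤ (2 * δ - 2 * (δ / 2 ^ k)) + δ / 2 ^ k := (norm_add_le _ _).trans (add_le_add (ih hy) h1)
      _ = _ := by rw [pow_succ]; field_simp; ring

/-- Rescale `t - x` to the unit ball, approximate it there within 1/2 and scale back: each link of
the chain halves the distance to `t`. -/
lemma exists_chainNet_succ {S : Finset T} (hS : ∀ s ∈ S, ‖s‖ ≤ 1)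
    (hcov : ∀ x : T, ‖x‖ ≤ 1 → ∃ s ∈ S, ‖x - s‖ ≤ 1 / 2) {t₀ : T} {δ : ℝ} (hδ : 0 < δ) {k : ℕ}
    {x t : T} (hx : x ∈ chainNet S t₀ δ k) (hxt : ‖t - x‖ ≤ δ / 2 ^ k) :
    ∃ y ∈ chainNet S t₀ δ (k + 1), ‖t - y‖ ≤ δ / 2 ^ (k + 1) ∧ ‖y - x‖ ≤ δ / 2 ^ k := by
  have hl : 0 < δ / 2 ^ k := by positivity
  set l := δ / 2 ^ k with hl_def
  obtain ⟨s, hs, hs'⟩ := hcov (l⁻¹ • (t - x)) (by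
    rw [norm_smul, norm_inv, Real.norm_of_nonneg hl.le]
    rw [inv_mul_le_iff₀ hl]
    simpa using hxt)
  refine ⟨x + l • s, ⟨x, hx, s, hs, rfl⟩, ?_, ?_⟩
  · have : t - (x + l • s) = l • (l⁻¹ • (t - x) - s) := by
      rw [smul_sub, smul_inv_smul₀ hl.ne']
      abel
    rw [this, norm_smul, Real.norm_of_nonneg hl.le, pow_succ, ← div_div, ← hl_def, div_eq_mul_one_div l]
    gcongr
  · rw [add_sub_cancel_left, norm_smul, Real.norm_of_nonneg hl.le]
    exact mul_le_of_le_one_right hl.le (hS s hs)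

variable (T) in
lemma exists_finset_half_cover [FiniteDimensional ℝ T] :
    ∃ S : Finset T, S.Nonempty ∧ (∀ s ∈ S, ‖s‖ ≤ 1) ∧
      ∀ x : T, ‖x‖ ≤ 1 → ∃ s ∈ S, ‖x - s‖ ≤ 1 / 2 := by
  have := FiniteDimensional.proper ℝ T
  obtain ⟨S, hSsub, hSfin, hcov⟩ :=
    (isCompact_closedBall (0 : T) 1).finite_cover_balls (show (0 : ℝ) < 1 / 2 by norm_num)
  have hcov' : ∀ x : T, ‖x‖ ≤ 1 → ∃ s ∈ S, ‖x - s‖ ≤ 1 / 2 := fun x hx => by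
    obtain ⟨s, hs, hxs⟩ := Set.mem_iUnion₂.1 (hcov (mem_closedBall_zero_iff.2 hx))
    exact ⟨s, hs, by rw [← dist_eq_norm]; exact (Metric.mem_ball.1 hxs).le⟩
  refine ⟨hSfin.toFinset, ?_, fun s hs => ?_, fun x hx => ?_⟩
  · obtain ⟨s, hs, -⟩ := hcov' 0 (by simp)
    exact ⟨s, by simpa using hs⟩
  · simpa using hSsub ((Set.Finite.mem_toFinset _).1 hs)
  · simpa using hcov' x hx

/-- Maximal inequality by **chaining**: if the increments of a random field over pairs of points at
distance at most `l` have uniformly bounded exponential moments after division by `2 l`, then the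
expected oscillation over a ball is at most a constant times the radius. -/
theorem chaining [FiniteDimensional ℝ T] {Ω : Type*} [MeasurableSpace Ω] (P : Measure Ω)
    [IsProbabilityMeasure P] {M : ℝ} (hM : 1 ≤ M) :
    ∃ C : ℝ, ∀ (t₀ : T) (δ : ℝ) (H : T → Ω → ℝ), 0 < δ → (∀ t, Measurable (H t)) →
      (∀ᵐ a ∂P, ContinuousOn (fun t => H t a) (Metric.closedBall t₀ (2 * δ))) →
      (∀ l > 0, ∀ s ∈ Metric.closedBall t₀ (2 * δ), ∀ t ∈ Metric.closedBall t₀ (2 * δ),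
        ‖s - t‖ ≤ l →
        ∫⁻ a, ENNReal.ofReal (Real.exp (|H s a - H t a| / (2 * l))) ∂P ≤ ENNReal.ofReal M) →
      ∃ D : Ω → ℝ≥0∞, Measurable D ∧ ∫⁻ a, D a ∂P ≤ ENNReal.ofReal (C * δ) ∧
        ∀ᵐ a ∂P, ∀ t ∈ Metric.closedBall t₀ δ, ENNReal.ofReal |H t a - H t₀ a| ≤ D a := by
  classical
  obtain ⟨S, hSne, hS1, hScov⟩ := exists_finset_half_cover T
  set B : ℝ := (S.card : ℝ) with hB
  have hB1 : 1 ≤ B := by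
    rw [hB]; exact_mod_cast hSne.card_pos
  have hM0 : 0 < M := by linarith
  set α : ℕ → ℝ := fun k => 2 * (1 / 2) ^ k * (((2 * k + 1) * Real.log B + Real.log M) + 1) with hα
  have hα0 : ∀ k, 0 ≤ α k := fun k => by
    have := Real.log_nonneg hB1
    have := Real.log_nonneg hM
    positivity
  have hαs : Summable α := by
    have h1 : Summable fun k : ℕ => (k : ℝ) ^ 1 * (1 / 2 : ℝ) ^ k :=
      summable_pow_mul_geometric_of_norm_lt_one 1 (by norm_num)
    have h2 : Summable fun k : ℕ => (1 / 2 : ℝ) ^ k := summable_geometric_two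
    refine ((h1.mul_left (4 * Real.log B)).add
      (h2.mul_left (2 * (Real.log B + Real.log M + 1)))).congr fun k => ?_
    simp only [hα]
    ring
  refine ⟨∑' k, α k, fun t₀ δ H hδ hHm hHc hHe => ?_⟩
  set F : ℕ → Finset T := fun k => (chainNet_finite S t₀ δ k).toFinset with hF
  have hFcard : ∀ k, ((F k).card : ℝ) ≤ B ^ k := fun k => by
    have := ncard_chainNet_le S t₀ δ k
    rw [Set.ncard_eq_toFinset_card _ (chainNet_finite S t₀ δ k)] at this
    rw [hB]
    exact_mod_cast this
  have hFball : ∀ k, ∀ x ∈ F k, x ∈ Metric.closedBall t₀ (2 * δ) := fun k x hx => by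
    rw [Metric.mem_closedBall, dist_eq_norm]
    have := norm_sub_le_of_mem_chainNet hS1 hδ ((Set.Finite.mem_toFinset _).1 hx)
    have : 0 < δ / 2 ^ k := by positivity
    linarith
  set l : ℕ → ℝ := fun k => δ / 2 ^ k with hl
  have hl0 : ∀ k, 0 < l k := fun k => by simp only [hl]; positivity
  set c : ℕ → ℝ := fun k => B ^ (2 * k + 1) * M with hc
  have hc0 : ∀ k, 0 < c k := fun k => by simp only [hc]; positivity
  have hc1 : ∀ k, 1 ≤ c k := fun k => by
    simp only [hc]
    exact one_le_mul_of_one_le_of_one_le (one_le_pow₀ hB1) hM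
  set pairs : ℕ → Finset (T × T) := fun k =>
    (F k ×ˢ F (k + 1)).filter fun p => ‖p.2 - p.1‖ ≤ l k with hpairs
  have hpcard : ∀ k, ((pairs k).card : ℝ) ≤ B ^ (2 * k + 1) := fun k => by
    calc ((pairs k).card : ℝ) ≤ ((F k ×ˢ F (k + 1)).card : ℝ) := by
          exact_mod_cast Finset.card_filter_le _ _
      _ = (F k).card * (F (k + 1)).card := by rw [Finset.card_product]; push_cast; rfl
      _ ≤ B ^ k * B ^ (k + 1) := by gcongr <;> apply hFcard
      _ = _ := by ring
  set e : ℕ → T × T → Ω → ℝ≥0∞ := fun k p a =>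
    ENNReal.ofReal (2 * l k / c k) *
      ENNReal.ofReal (Real.exp (|H p.2 a - H p.1 a| / (2 * l k))) with he
  have hem : ∀ k p, Measurable (e k p) := fun k p => by
    refine Measurable.const_mul ?_ _
    have h1 := hHm p.1
    have h2 := hHm p.2
    fun_prop
  -- Majorant of all level-k increments at once. Replacing the maximum over pairs by a sum is
  -- harmless because `c k` bounds the number of pairs times the exponential moment.
  set Δ : ℕ → Ω → ℝ≥0∞ := fun k a =>
    ENNReal.ofReal (2 * l k * Real.log (c k)) + ∑ p ∈ pairs k, e k p a with hΔ
  have hΔm : ∀ k, Measurable (Δ k) := fun k =>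
    measurable_const.add (Finset.measurable_fun_sum _ fun p _ => hem k p)
  have hΔle : ∀ k, ∀ p ∈ pairs k, ∀ a, ENNReal.ofReal |H p.2 a - H p.1 a| ≤ Δ k a := by
    intro k p hp a
    set x := |H p.2 a - H p.1 a| / (2 * l k) with hx
    have hxl : |H p.2 a - H p.1 a| = 2 * l k * x := by
      have := (hl0 k).ne'
      rw [hx]; field_simp
    -- This is 1 + z ≤ exp z at z = x - log c, with the 1 dropped.
    have h1 : x ≤ Real.log (c k) + Real.exp x / c k := by
      have := Real.add_one_le_exp (x - Real.log (c k))
      rw [Real.exp_sub, Real.exp_log (hc0 k)] at this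
      linarith
    calc ENNReal.ofReal |H p.2 a - H p.1 a|
        ≤ ENNReal.ofReal (2 * l k * Real.log (c k) + 2 * l k / c k * Real.exp x) := by
          refine ENNReal.ofReal_le_ofReal ?_
          rw [hxl]
          have := mul_le_mul_of_nonneg_left h1 (mul_pos two_pos (hl0 k)).le
          refine this.trans_eq ?_
          ring
      _ ≤ ENNReal.ofReal (2 * l k * Real.log (c k)) + e k p a := by
          refine ENNReal.ofReal_add_le.trans ?_
          rw [ENNReal.ofReal_mul (div_pos (mul_pos two_pos (hl0 k)) (hc0 k)).le]
      _ ≤ _ := by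
          simp only [hΔ]
          gcongr
          exact Finset.single_le_sum (f := fun p => e k p a) (fun _ _ => zero_le) hp
  have hΔint : ∀ k, ∫⁻ a, Δ k a ∂P ≤ ENNReal.ofReal (α k * δ) := by
    intro k
    have hcoef : 0 ≤ 2 * l k / c k := (div_pos (mul_pos two_pos (hl0 k)) (hc0 k)).le
    have hlog : 0 ≤ 2 * l k * Real.log (c k) :=
      mul_nonneg (mul_pos two_pos (hl0 k)).le (Real.log_nonneg (hc1 k))
    calc ∫⁻ a, Δ k a ∂P
        = ENNReal.ofReal (2 * l k * Real.log (c k)) + ∑ p ∈ pairs k, ∫⁻ a, e k p a ∂P := by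
          simp only [hΔ]
          rw [lintegral_add_left measurable_const, lintegral_finsetSum _ fun p _ => hem k p]
          simp
      _ ≤ ENNReal.ofReal (2 * l k * Real.log (c k)) +
          ∑ _p ∈ pairs k, ENNReal.ofReal (2 * l k / c k) * ENNReal.ofReal M := by
          gcongr with p hp
          simp only [hpairs, Finset.mem_filter, Finset.mem_product] at hp
          simp only [he]
          rw [lintegral_const_mul' _ _ ENNReal.ofReal_ne_top]
          gcongr
          exact hHe _ (hl0 k) _ (hFball _ _ hp.1.2) _ (hFball _ _ hp.1.1) hp.2
      _ = ENNReal.ofReal (2 * l k * Real.log (c k) + (pairs k).card * (2 * l k / c k * M)) := by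
          rw [Finset.sum_const, nsmul_eq_mul, ← ENNReal.ofReal_mul hcoef,
            ← ENNReal.ofReal_natCast, ← ENNReal.ofReal_mul (by positivity),
            ← ENNReal.ofReal_add hlog (by positivity)]
      _ ≤ ENNReal.ofReal (2 * l k * Real.log (c k) + B ^ (2 * k + 1) * (2 * l k / c k * M)) := by
          refine ENNReal.ofReal_le_ofReal ?_
          gcongr
          exact hpcard k
      _ = ENNReal.ofReal (α k * δ) := by
          congr 1
          have hBp : B ^ (2 * k + 1) ≠ 0 := by positivity
          have hlc : Real.log (c k) = (2 * k + 1) * Real.log B + Real.log M := by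
            simp only [hc]
            rw [Real.log_mul hBp hM0.ne', Real.log_pow]
            push_cast
            ring
          rw [hlc]
          simp only [hc, hα, hl, one_div, inv_pow]
          field_simp
  refine ⟨fun a => ∑' k, Δ k a, Measurable.tsum hΔm, ?_, ?_⟩
  · rw [lintegral_tsum fun k => (hΔm k).aemeasurable, ← tsum_mul_right,
      ENNReal.ofReal_tsum_of_nonneg (fun k => mul_nonneg (hα0 k) hδ.le) (hαs.mul_right δ)]
    exact ENNReal.tsum_le_tsum hΔint
  · filter_upwards [hHc] with a ha t ht
    have htδ : ‖t - t₀‖ ≤ δ := by rwa [Metric.mem_closedBall, dist_eq_norm] at ht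
    -- Follow a chain of net points from `t₀` towards `t`; the increments telescope.
    have hchain : ∀ k, ∃ x ∈ F k, ‖t - x‖ ≤ l k ∧
        ENNReal.ofReal |H x a - H t₀ a| ≤ ∑ j ∈ Finset.range k, Δ j a := by
      intro k
      induction k with
      | zero => exact ⟨t₀, by simp [hF, chainNet], by simpa [hl] using htδ, by simp⟩
      | succ k ih =>
        obtain ⟨x, hx, hxt, hxs⟩ := ih
        obtain ⟨y, hy, hty, hyx⟩ := exists_chainNet_succ hS1 hScov hδ
          ((Set.Finite.mem_toFinset _).1 hx) hxt
        have hyF : y ∈ F (k + 1) := (Set.Finite.mem_toFinset _).2 hy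
        have hp : (x, y) ∈ pairs k := by
          simp only [hpairs, Finset.mem_filter, Finset.mem_product]
          exact ⟨⟨hx, hyF⟩, hyx⟩
        refine ⟨y, hyF, hty, ?_⟩
        rw [Finset.sum_range_succ]
        calc _ ≤ ENNReal.ofReal (|H x a - H t₀ a| + |H y a - H x a|) := by
              refine ENNReal.ofReal_le_ofReal ?_
              rw [add_comm]
              exact abs_sub_le _ _ _
          _ ≤ _ := ENNReal.ofReal_add_le.trans (add_le_add hxs (hΔle k _ hp a))
    -- Path continuity carries the bound from the net points to `t`.
    refine ENNReal.le_of_forall_pos_le_add fun ε hε _ => ?_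
    have htm : t ∈ Metric.closedBall t₀ (2 * δ) :=
      Metric.closedBall_subset_closedBall (by linarith) ht
    obtain ⟨η, hη, hcont⟩ := Metric.continuousOn_iff.1 ha t htm ε hε
    have hlt : Tendsto l atTop (𝓝 0) := by
      have := (tendsto_pow_atTop_nhds_zero_of_lt_one (r := (1 / 2 : ℝ)) (by norm_num)
        (by norm_num)).const_mul δ
      rw [mul_zero] at this
      refine this.congr fun k => ?_
      simp only [hl, one_div, inv_pow]
      rfl
    obtain ⟨k, hk⟩ := (hlt.eventually_lt_const hη).exists
    obtain ⟨x, hx, hxt, hxs⟩ := hchain k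
    have hxε := hcont x (hFball k x hx) (by
      rw [dist_comm, dist_eq_norm]
      exact hxt.trans_lt hk)
    calc ENNReal.ofReal |H t a - H t₀ a|
        ≤ ENNReal.ofReal (|H x a - H t₀ a| + ε) := by
          refine ENNReal.ofReal_le_ofReal ?_
          rw [Real.dist_eq, abs_sub_comm] at hxε
          have := abs_sub_le (H t a) (H x a) (H t₀ a)
          linarith
      _ ≤ ENNReal.ofReal |H x a - H t₀ a| + ε := by
          refine ENNReal.ofReal_add_le.trans ?_
          simp
      _ ≤ _ := by
          gcongr
          exact hxs.trans (ENNReal.sum_le_tsum _)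

end chaining

/-! ### Stochastic equicontinuity -/

lemma empProc_apply {Ω 𝒳 : Type*} [MeasurableSpace 𝒳] {μ : Measure 𝒳} {X : ℕ → Ω → 𝒳} {m n : ℕ}
    {u : 𝒳 → Vec m} (hu : Integrable u μ) (a : Ω) (j : Fin m) :
    empProc μ X n u a j = empProc μ X n (fun x => u x j) a :=
  (empProc_clm (EuclideanSpace.proj j : Vec m →L[ℝ] ℝ) hu a).symm

/-- A crude pathwise bound that uses no cancellation. It suffices for continuity of paths and for
the part where the Lipschitz factor is large. -/
lemma abs_empProc_le {Ω 𝒳 : Type*} [MeasurableSpace 𝒳] {μ : Measure 𝒳} {X : ℕ → Ω → 𝒳} {n : ℕ}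
    {u b : 𝒳 → ℝ} (hb : Integrable b μ) (hub : ∀ᵐ x ∂μ, |u x| ≤ b x)
    {a : Ω} (ha : ∀ i, |u (X i a)| ≤ b (X i a)) :
    |empProc μ X n u a| ≤ (√(n : ℝ))⁻¹ * ∑ i ∈ Finset.range n, (b (X i a) + ∫ x, b x ∂μ) := by
  rw [empProc, smul_eq_mul, abs_mul, abs_of_nonneg (by positivity : (0 : ℝ) ≤ (√(n : ℝ))⁻¹)]
  gcongr
  refine (Finset.abs_sum_le_sum_abs _ _).trans (Finset.sum_le_sum fun i _ => ?_)
  refine (abs_sub _ _).trans (add_le_add (ha i) ?_)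
  rw [← Real.norm_eq_abs]
  exact norm_integral_le_of_norm_le hb (hub.mono fun x hx => by rwa [Real.norm_eq_abs])

section equicontinuity

variable {Ω 𝒳 : Type*} [MeasurableSpace Ω] [MeasurableSpace 𝒳] {P : Measure Ω}
  [IsProbabilityMeasure P] {μ : Measure 𝒳} [IsProbabilityMeasure μ] {X : ℕ → Ω → 𝒳}

variable {T : Type*} [NormedAddCommGroup T] [NormedSpace ℝ T] [FiniteDimensional ℝ T]

/-- Maximal inequality for the part of the empirical process where the Lipschitz factor is at most
`√n`. -/
lemma exists_bound_empProc_truncated (hX : ∀ i, Measurable (X i))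
    (hlaw : ∀ i, P.map (X i) = μ) (hindep : iIndepFun X P) {v : ℝ} (hv0 : 0 ≤ v) :
    ∃ C : ℝ, 0 ≤ C ∧ ∀ (t₀ : T) (δ : ℝ) (n : ℕ) (g : T → 𝒳 → ℝ) (φ : 𝒳 → ℝ), 0 < δ → 0 < n →
      (∀ t, Measurable (g t)) → Integrable φ μ →
      (∀ x, 0 ≤ φ x) → (∀ x, φ x ≤ √(n : ℝ)) → Integrable (fun x => φ x ^ 2) μ →
      ∫ x, φ x ^ 2 ∂μ ≤ v → (∀ x, g t₀ x = 0) →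
      (∀ᵐ x ∂μ, ∀ s ∈ Metric.closedBall t₀ (2 * δ), ∀ t ∈ Metric.closedBall t₀ (2 * δ),
        |g s x - g t x| ≤ φ x * ‖s - t‖) →
      ∃ D : Ω → ℝ≥0∞, Measurable D ∧ ∫⁻ a, D a ∂P ≤ ENNReal.ofReal (C * δ) ∧
        ∀ᵐ a ∂P, ∀ t ∈ Metric.closedBall t₀ δ, ENNReal.ofReal |empProc μ X n (g t) a| ≤ D a := by
  obtain ⟨C, hC⟩ := chaining (T := T) P (M := 2 * Real.exp (v / 4)) (by
    have := Real.add_one_le_exp (v / 4)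
    linarith)
  -- `chaining` gives no sign for its constant. The constant depends only on `v` (through M), not on
  -- `n`, `δ` or `g`.
  refine ⟨max C 0, le_max_right _ _, ?_⟩
  intro t₀ δ n g φ hδ hn hg hφi hφ0 hφn hφ2 hφv hg0 hLip
  have hs : 0 < √(n : ℝ) := Real.sqrt_pos.2 (by exact_mod_cast hn)
  have ht₀ : t₀ ∈ Metric.closedBall t₀ (2 * δ) := Metric.mem_closedBall_self (by positivity)
  have hgi : ∀ s ∈ Metric.closedBall t₀ (2 * δ), Integrable (g s) μ := fun s hs => by
    refine (hφi.mul_const ‖s - t₀‖).mono' (hg s).aestronglyMeasurable ?_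
    filter_upwards [hLip] with x hx
    simpa [hg0] using hx s hs t₀ ht₀
  have hdiff : ∀ s ∈ Metric.closedBall t₀ (2 * δ), ∀ t ∈ Metric.closedBall t₀ (2 * δ), ∀ a,
      empProc μ X n (g s) a - empProc μ X n (g t) a = empProc μ X n (fun x => g s x - g t x) a :=
    fun s hs t ht a => (empProc_sub (hgi s hs) (hgi t ht) a).symm
  have hzero : ∀ a, empProc μ X n (g t₀) a = 0 := fun a => by simp [empProc, hg0]
  have hcont : ∀ᵐ a ∂P,
      ContinuousOn (fun t => empProc μ X n (g t) a) (Metric.closedBall t₀ (2 * δ)) := by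
    filter_upwards [ae_comp_of_law hX hlaw hLip] with a ha
    set L : ℝ := (√(n : ℝ))⁻¹ * ∑ i ∈ Finset.range n, (φ (X i a) + ∫ x, φ x ∂μ) with hL
    have hL0 : 0 ≤ L := mul_nonneg (by positivity) (Finset.sum_nonneg fun i _ =>
      add_nonneg (hφ0 _) (integral_nonneg hφ0))
    refine LipschitzOnWith.continuousOn (K := ⟨L, hL0⟩) ?_
    refine LipschitzOnWith.of_dist_le_mul fun s hs t ht => ?_
    rw [Real.dist_eq, hdiff s hs t ht, dist_eq_norm]
    refine (abs_empProc_le (b := fun x => φ x * ‖s - t‖) (hφi.mul_const _) ?_ ?_).trans_eq ?_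
    · filter_upwards [hLip] with x hx using hx s hs t ht
    · exact fun i => ha i s hs t ht
    · rw [integral_mul_const]
      change _ = L * ‖s - t‖
      simp only [hL, ← add_mul, ← Finset.sum_mul, mul_assoc]
  have hexp : ∀ l > 0, ∀ s ∈ Metric.closedBall t₀ (2 * δ), ∀ t ∈ Metric.closedBall t₀ (2 * δ),
      ‖s - t‖ ≤ l → ∫⁻ a, ENNReal.ofReal
        (Real.exp (|empProc μ X n (g s) a - empProc μ X n (g t) a| / (2 * l))) ∂P ≤
          ENNReal.ofReal (2 * Real.exp (v / 4)) := by
    intro l hl s hs t ht hst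
    -- Divided by `l`, the increment is bounded by φ ≤ √n and has second moment at most `v`, as
    -- `lintegral_exp_empProc_le` requires.
    have hu : ∀ᵐ x ∂μ, |l⁻¹ * (g s x - g t x)| ≤ φ x := by
      filter_upwards [hLip] with x hx
      rw [abs_mul, abs_of_pos (inv_pos.2 hl), inv_mul_le_iff₀ hl, mul_comm l]
      exact (hx s hs t ht).trans (by gcongr; exact hφ0 x)
    have hum : Measurable fun x => l⁻¹ * (g s x - g t x) := ((hg s).sub (hg t)).const_mul _
    have := lintegral_exp_empProc_le hX hlaw hindep hn hum
      (hu.mono fun x hx => hx.trans (hφn x)) (v := v) (le_trans (integral_mono_of_nonneg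
        (ae_of_all _ fun x => sq_nonneg _) hφ2 (hu.mono fun x hx => by
          change (l⁻¹ * (g s x - g t x)) ^ 2 ≤ φ x ^ 2
          rw [← sq_abs]
          exact pow_le_pow_left₀ (abs_nonneg _) hx 2)) hφv)
    refine le_of_eq_of_le (lintegral_congr fun a => ?_) this
    have hsm := empProc_const_smul (μ := μ) (X := X) (n := n) l⁻¹ (fun x => g s x - g t x) a
    simp only [smul_eq_mul] at hsm
    rw [hsm, hdiff s hs t ht, abs_mul, abs_of_pos (inv_pos.2 hl)]
    congr 2
    field_simp
  obtain ⟨D, hDm, hDi, hD⟩ := hC t₀ δ (fun t => empProc μ X n (g t)) hδ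
    (fun t => measurable_empProc hX (hg t)) hcont hexp
  refine ⟨D, hDm, hDi.trans (ENNReal.ofReal_le_ofReal ?_), ?_⟩
  · gcongr
    exact le_max_left _ _
  · filter_upwards [hD] with a ha t ht
    simpa [hzero] using ha t ht

/-- **Stochastic equicontinuity** of the empirical process indexed by real functions that are
Lipschitz in a finite-dimensional parameter, with a square integrable Lipschitz factor. -/
theorem stochastic_equicontinuity_real (hX : ∀ i, Measurable (X i))
    (hlaw : ∀ i, P.map (X i) = μ) (hindep : iIndepFun X P) {t₀ : T} {r : ℝ}
    {g : T → 𝒳 → ℝ} (hg : ∀ t, Measurable (g t)) {φ : 𝒳 → ℝ} (hφm : Measurable φ)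
    (hφ0 : ∀ x, 0 ≤ φ x) (hφ : MemLp φ 2 μ)
    (hLip : ∀ᵐ x ∂μ, ∀ s ∈ Metric.ball t₀ r, ∀ t ∈ Metric.ball t₀ r,
      |g s x - g t x| ≤ φ x * ‖s - t‖) :
    ∃ C : ℝ, 0 ≤ C ∧ ∀ δ > 0, 2 * δ < r → ∀ n : ℕ, 0 < n →
      ∃ D : Ω → ℝ≥0∞, Measurable D ∧ ∫⁻ a, D a ∂P ≤ ENNReal.ofReal (C * δ) ∧
        ∀ᵐ a ∂P, ∀ t ∈ Metric.closedBall t₀ δ,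
          ENNReal.ofReal |empProc μ X n (fun x => g t x - g t₀ x) a| ≤ D a := by
  have hφi : Integrable φ μ := hφ.integrable (by norm_num)
  have hφ2 : Integrable (fun x => φ x ^ 2) μ := hφ.integrable_sq
  set v := ∫ x, φ x ^ 2 ∂μ with hv
  have hv0 : 0 ≤ v := integral_nonneg fun x => sq_nonneg _
  obtain ⟨C, hC0, hC⟩ := exists_bound_empProc_truncated (T := T) hX hlaw hindep hv0
  -- `C` comes from the part where φ ≤ √n, treated by chaining, and `2 * v` from the part where φ >
  -- √n.
  refine ⟨C + 2 * v, by positivity, fun δ hδ hδr n hn => ?_⟩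
  have hs : 0 < √(n : ℝ) := Real.sqrt_pos.2 (by exact_mod_cast hn)
  set A : Set 𝒳 := {x | φ x ≤ √(n : ℝ)} with hA
  have hAm : MeasurableSet A := measurableSet_le hφm measurable_const
  have hsub : Metric.closedBall t₀ (2 * δ) ⊆ Metric.ball t₀ r := Metric.closedBall_subset_ball hδr
  have hsub' : Metric.closedBall t₀ δ ⊆ Metric.closedBall t₀ (2 * δ) :=
    Metric.closedBall_subset_closedBall (by linarith)
  have ht₀ : t₀ ∈ Metric.ball t₀ r := Metric.mem_ball_self (by linarith)
  have hgd : ∀ t, Measurable fun x => g t x - g t₀ x := fun t => (hg t).sub (hg t₀)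
  have hsqle : ∀ x, A.indicator φ x ^ 2 ≤ φ x ^ 2 := fun x =>
    pow_le_pow_left₀ (Set.indicator_nonneg (fun _ _ => hφ0 _) x)
      (Set.indicator_le_self' (fun _ _ => hφ0 _) x) 2
  have hsqi : Integrable (fun x => A.indicator φ x ^ 2) μ :=
    hφ2.mono' ((hφm.indicator hAm).pow_const 2).aestronglyMeasurable
      (ae_of_all _ fun x => by rw [Real.norm_of_nonneg (sq_nonneg _)]; exact hsqle x)
  obtain ⟨D, hDm, hDi, hD⟩ := hC t₀ δ n
    (fun t => A.indicator fun x => g t x - g t₀ x) (A.indicator φ) hδ hn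
    (fun t => (hgd t).indicator hAm) (hφi.indicator hAm)
    (Set.indicator_nonneg fun x _ => hφ0 x)
    (fun x => by
      by_cases hx : x ∈ A
      · rw [Set.indicator_of_mem hx]; exact hx
      · rw [Set.indicator_of_notMem hx]; exact hs.le)
    hsqi (integral_mono hsqi hφ2 hsqle)
    (fun x => by simp)
    (by
      filter_upwards [hLip] with x hx s hs t ht
      by_cases hxA : x ∈ A
      · simpa [hxA] using hx s (hsub hs) t (hsub ht)
      · simp [hxA])
  set ψ : 𝒳 → ℝ := Aᶜ.indicator φ with hψ
  have hψm : Measurable ψ := hφm.indicator hAm.compl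
  have hψ0 : ∀ x, 0 ≤ ψ x := Set.indicator_nonneg fun x _ => hφ0 x
  have hψi : Integrable ψ μ := hφi.indicator hAm.compl
  -- On φ > √n one has √n φ ≤ φ²; this is where square integrability of the Lipschitz factor enters
  -- for the tail.
  have hψle : √(n : ℝ) * ∫ x, ψ x ∂μ ≤ v := by
    rw [← integral_const_mul]
    refine integral_mono (hψi.const_mul _) hφ2 fun x => ?_
    by_cases hx : x ∈ A
    · simp only [hψ]
      rw [Set.indicator_of_notMem (by simpa using hx)]
      simpa using sq_nonneg (φ x)
    · have hx' : √(n : ℝ) ≤ φ x := (not_le.1 hx).le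
      simp only [hψ]
      rw [Set.indicator_of_mem (by simpa using hx), sq]
      exact mul_le_mul_of_nonneg_right hx' (hφ0 x)
  -- Pathwise majorant of the tail part. The summands and their centring contribute equally, so its
  -- mean is 2δ√n E ψ ≤ 2vδ.
  set R : Ω → ℝ := fun a =>
    (√(n : ℝ))⁻¹ * ∑ i ∈ Finset.range n, (δ * ψ (X i a) + ∫ x, δ * ψ x ∂μ) with hR
  have hψX : ∀ i, Integrable (fun a => ψ (X i a)) P := fun i => by
    rw [← hlaw i] at hψi
    exact hψi.comp_measurable (hX i)
  have hψXint : ∀ i, ∫ a, ψ (X i a) ∂P = ∫ x, ψ x ∂μ := fun i => by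
    rw [← hlaw i, integral_map (hX i).aemeasurable hψm.aestronglyMeasurable]
  have hRm : Measurable R := (Finset.measurable_fun_sum _ fun i _ =>
    ((hψm.comp (hX i)).const_mul δ).add_const _).const_mul _
  have hsumi : ∀ i, Integrable (fun a => δ * ψ (X i a) + ∫ x, δ * ψ x ∂μ) P :=
    fun i => ((hψX i).const_mul δ).add (integrable_const _)
  have hRi : Integrable R P := (integrable_finsetSum _ fun i _ => hsumi i).const_mul _
  have hR0 : ∀ a, 0 ≤ R a := fun a => mul_nonneg (by positivity) (Finset.sum_nonneg fun i _ =>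
    add_nonneg (mul_nonneg hδ.le (hψ0 _)) (integral_nonneg fun x => mul_nonneg hδ.le (hψ0 x)))
  have hRint : ∫ a, R a ∂P ≤ 2 * v * δ := by
    have h1 : ∀ i, ∫ a, (δ * ψ (X i a) + ∫ x, δ * ψ x ∂μ) ∂P = 2 * δ * ∫ x, ψ x ∂μ := fun i => by
      rw [integral_add ((hψX i).const_mul δ) (integrable_const _), integral_const_mul, hψXint,
        integral_const_mul]
      simp
      ring
    simp only [hR]
    rw [integral_const_mul, integral_finsetSum _ fun i _ => hsumi i]
    simp only [h1, Finset.sum_const, Finset.card_range, nsmul_eq_mul]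
    have h2 : (√(n : ℝ))⁻¹ * (n * (2 * δ * ∫ x, ψ x ∂μ)) =
        2 * δ * (√(n : ℝ) * ∫ x, ψ x ∂μ) := by
      nth_rewrite 2 [← Real.mul_self_sqrt (Nat.cast_nonneg n : (0 : ℝ) ≤ n)]
      field_simp
    rw [h2]
    nlinarith
  have hLipA : ∀ᵐ x ∂μ, ∀ t ∈ Metric.closedBall t₀ δ,
      |Aᶜ.indicator (fun x => g t x - g t₀ x) x| ≤ δ * ψ x := by
    filter_upwards [hLip] with x hx t ht
    by_cases hxA : x ∈ A
    · simp [hψ, hxA]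
    · have h1 := hx t (hsub (hsub' ht)) t₀ ht₀
      rw [Metric.mem_closedBall, dist_eq_norm] at ht
      simp only [hψ, Set.indicator_of_mem (show x ∈ Aᶜ from hxA)]
      exact h1.trans (by rw [mul_comm]; exact mul_le_mul_of_nonneg_right ht (hφ0 x))
  refine ⟨fun a => D a + ENNReal.ofReal (R a), hDm.add hRm.ennreal_ofReal, ?_, ?_⟩
  · rw [lintegral_add_left hDm, ← ofReal_integral_eq_lintegral_ofReal hRi (ae_of_all _ hR0),
      add_mul, ENNReal.ofReal_add (by positivity) (by positivity)]
    exact add_le_add hDi (ENNReal.ofReal_le_ofReal hRint)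
  · filter_upwards [hD, ae_comp_of_law hX hlaw hLipA] with a ha haR t ht
    have hint : Integrable (fun x => g t x - g t₀ x) μ := by
      refine (hφi.mul_const ‖t - t₀‖).mono' (hgd t).aestronglyMeasurable ?_
      filter_upwards [hLip] with x hx using hx t (hsub (hsub' ht)) t₀ ht₀
    have hsplit : empProc μ X n (fun x => g t x - g t₀ x) a =
        empProc μ X n (A.indicator fun x => g t x - g t₀ x) a +
          empProc μ X n (Aᶜ.indicator fun x => g t x - g t₀ x) a := by
      rw [← empProc_add (hint.indicator hAm) (hint.indicator hAm.compl)]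
      congr 1
      ext x
      exact (congrFun (Set.indicator_self_add_compl A fun x => g t x - g t₀ x) x).symm
    have hRle : |empProc μ X n (Aᶜ.indicator fun x => g t x - g t₀ x) a| ≤ R a :=
      abs_empProc_le (b := fun x => δ * ψ x) (hψi.const_mul δ)
        (hLipA.mono fun x hx => hx t ht) fun i => haR i t ht
    rw [hsplit]
    calc _ ≤ ENNReal.ofReal (|empProc μ X n (A.indicator fun x => g t x - g t₀ x) a| +
          |empProc μ X n (Aᶜ.indicator fun x => g t x - g t₀ x) a|) :=
          ENNReal.ofReal_le_ofReal (abs_add_le _ _)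
      _ ≤ _ := ENNReal.ofReal_add_le.trans
          (add_le_add (ha t ht) (ENNReal.ofReal_le_ofReal hRle))

lemma enorm_le_sum_ofReal_abs {m : ℕ} (v : Vec m) : ‖v‖ₑ ≤ ∑ j, ENNReal.ofReal |v j| := by
  have h : v = ∑ j, EuclideanSpace.single j (v j) := by
    ext k
    simp
  calc ‖v‖ₑ ≤ ∑ j, ‖EuclideanSpace.single j (v j)‖ₑ := by
        conv_lhs => rw [h]
        exact enorm_sum_le _ _
    _ = _ := Finset.sum_congr rfl fun j _ => by
        rw [← ofReal_norm, PiLp.norm_single, Real.norm_eq_abs]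

lemma abs_apply_le_norm {m : ℕ} (v : Vec m) (j : Fin m) : |v j| ≤ ‖v‖ := by
  simpa using PiLp.norm_apply_le v j

/-- **Stochastic equicontinuity** of the empirical process indexed by vector-valued functions. -/
theorem stochastic_equicontinuity (hX : ∀ i, Measurable (X i))
    (hlaw : ∀ i, P.map (X i) = μ) (hindep : iIndepFun X P) {t₀ : T} {r : ℝ} {m : ℕ}
    {g : T → 𝒳 → Vec m} (hg : ∀ t, Measurable (g t)) {φ : 𝒳 → ℝ} (hφm : Measurable φ)
    (hφ0 : ∀ x, 0 ≤ φ x) (hφ : MemLp φ 2 μ)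
    (hLip : ∀ᵐ x ∂μ, ∀ s ∈ Metric.ball t₀ r, ∀ t ∈ Metric.ball t₀ r,
      ‖g s x - g t x‖ ≤ φ x * ‖s - t‖) (hgi : Integrable (g t₀) μ) :
    ∃ C : ℝ, 0 ≤ C ∧ ∀ δ > 0, 2 * δ < r → ∀ n : ℕ, 0 < n →
      ∃ D : Ω → ℝ≥0∞, Measurable D ∧ ∫⁻ a, D a ∂P ≤ ENNReal.ofReal (C * δ) ∧
        ∀ᵐ a ∂P, ∀ t ∈ Metric.closedBall t₀ δ,
          ‖empProc μ X n (g t) a - empProc μ X n (g t₀) a‖ₑ ≤ D a := by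
  have hgm : ∀ (j : Fin m) t, Measurable fun x => g t x j := fun j t =>
    (EuclideanSpace.proj (𝕜 := ℝ) j).continuous.measurable.comp (hg t)
  choose C hC0 hC using fun j : Fin m => stochastic_equicontinuity_real (T := T) hX hlaw hindep
    (t₀ := t₀) (r := r) (hgm j) hφm hφ0 hφ (hLip.mono fun x hx s hs t ht =>
      (abs_apply_le_norm (g s x - g t x) j).trans (hx s hs t ht))
  refine ⟨∑ j, C j, Finset.sum_nonneg fun j _ => hC0 j, fun δ hδ hδr n hn => ?_⟩
  choose D hDm hDi hD using fun j => hC j δ hδ hδr n hn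
  refine ⟨fun a => ∑ j, D j a, Finset.measurable_fun_sum _ fun j _ => hDm j, ?_, ?_⟩
  · rw [lintegral_finsetSum _ fun j _ => hDm j, Finset.sum_mul,
      ENNReal.ofReal_sum_of_nonneg fun j _ => mul_nonneg (hC0 j) hδ.le]
    exact Finset.sum_le_sum fun j _ => hDi j
  · have hφi : Integrable φ μ := hφ.integrable (by norm_num)
    filter_upwards [ae_all_iff.2 hD] with a ha t ht
    have ht' : t ∈ Metric.ball t₀ r := Metric.closedBall_subset_ball (by linarith) ht
    have hdi : Integrable (fun x => g t x - g t₀ x) μ := by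
      refine (hφi.mul_const ‖t - t₀‖).mono' ((hg t).sub (hg t₀)).aestronglyMeasurable ?_
      filter_upwards [hLip] with x hx
        using hx t ht' t₀ (Metric.mem_ball_self (by linarith))
    have hti : Integrable (g t) μ := by
      have := hdi.add hgi
      refine this.congr (ae_of_all _ fun x => ?_)
      simp
    rw [← empProc_sub hti hgi]
    refine (enorm_le_sum_ofReal_abs _).trans (Finset.sum_le_sum fun j _ => ?_)
    rw [empProc_apply hdi]
    exact ha j t ht

end equicontinuity

/-! ### Central limit theorem for two independent samples -/

section clt

variable {Ω 𝒳 : Type*} [MeasurableSpace Ω] [MeasurableSpace 𝒳] {P : Measure Ω}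
  {μ : Measure 𝒳} {X : ℕ → Ω → 𝒳}

/-- The Cramér–Wold reduction to one dimension. -/
lemma charFun_map_eq_charFun_map_inner {E : Type*} [NormedAddCommGroup E] [InnerProductSpace ℝ E]
    [MeasurableSpace E] [BorelSpace E] [SecondCountableTopology E] {W : Ω → E}
    (hW : Measurable W) (t : E) : charFun (P.map W) t = charFun (P.map fun a => ⟪t, W a⟫) 1 := by
  have h1 : AEStronglyMeasurable (fun x : E => Complex.exp (⟪x, t⟫ * Complex.I)) (P.map W) :=
    Measurable.aestronglyMeasurable (by fun_prop)
  have h2 : AEStronglyMeasurable (fun x : ℝ => Complex.exp (⟪x, (1 : ℝ)⟫ * Complex.I))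
      (P.map fun a => ⟪t, W a⟫) := Measurable.aestronglyMeasurable (by fun_prop)
  rw [charFun_apply, charFun_apply, integral_map hW.aemeasurable h1,
    integral_map (by fun_prop) h2]
  simp [real_inner_comm]

variable [IsProbabilityMeasure P]

lemma tendstoInDistribution_empProc (hX : ∀ i, Measurable (X i)) (hlaw : ∀ i, P.map (X i) = μ)
    (hindep : iIndepFun X P) {f : 𝒳 → ℝ} (hf : Measurable f) (hf2 : MemLp f 2 μ) :
    TendstoInDistribution (fun n => empProc μ X n f) atTop (id : ℝ → ℝ) (fun _ => P)
      (gaussianReal 0 Var[f; μ].toNNReal) := by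
  have hident : ∀ i, IdentDistrib (fun a => f (X i a)) (fun a => f (X 0 a)) P P := fun i =>
    (IdentDistrib.mk (hX i).aemeasurable (hX 0).aemeasurable (by rw [hlaw, hlaw])).comp hf
  have hvar : Var[fun a => f (X 0 a); P] = Var[f; μ] := by
    rw [← hlaw 0, variance_map hf.aemeasurable (hX 0).aemeasurable]
    rfl
  have hmean : ∫ a, f (X 0 a) ∂P = ∫ x, f x ∂μ := by
    rw [← hlaw 0, integral_map (hX 0).aemeasurable hf.aestronglyMeasurable]
  have hL2 : MemLp (fun a => f (X 0 a)) 2 P := by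
    rw [← hlaw 0] at hf2
    exact hf2.comp_of_map (hX 0).aemeasurable
  have h := tendstoInDistribution_inv_sqrt_mul_sum_sub (X := fun i a => f (X i a)) (P := P)
    (Y := (id : ℝ → ℝ)) (P' := gaussianReal 0 Var[f; μ].toNNReal)
    (by rw [hvar]; exact HasLaw.id) hL2 (hindep.comp (fun _ => f) fun _ => hf) hident
  refine h.congr (fun n => ae_of_all _ fun a => ?_) (ae_of_all _ fun _ => rfl)
  simp [empProc, hmean]

/-- The scalar central limit theorem along the sample sizes `n k`, combined with Slutsky's theorem
for the converging factor `c k`. -/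
lemma tendsto_charFun_const_mul_empProc (hX : ∀ i, Measurable (X i))
    (hlaw : ∀ i, P.map (X i) = μ) (hindep : iIndepFun X P) {f : 𝒳 → ℝ} (hf : Measurable f)
    (hf2 : MemLp f 2 μ) {n : ℕ → ℕ} (hn : Tendsto n atTop atTop) {c : ℕ → ℝ} {c₀ : ℝ}
    (hc : Tendsto c atTop (𝓝 c₀)) :
    Tendsto (fun k => charFun (P.map fun a => c k * empProc μ X (n k) f a) 1) atTop
      (𝓝 (Complex.exp (-((c₀ ^ 2 * Var[f; μ] / 2 : ℝ) : ℂ)))) := by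
  have h := tendstoInDistribution_empProc hX hlaw hindep hf hf2
  have h1 : TendstoInDistribution (fun k => empProc μ X (n k) f) atTop (id : ℝ → ℝ)
      (fun _ => P) (gaussianReal 0 Var[f; μ].toNNReal) :=
    ⟨fun k => h.forall_aemeasurable (n k), h.aemeasurable_limit, h.tendsto.comp hn⟩
  have h2 := h1.continuous_comp_prodMk_of_tendstoInMeasure_const
    (g := fun p : ℝ × ℝ => p.2 * p.1) (by fun_prop) (Y := fun k (_ : Ω) => c k) (c := c₀)
    (tendstoInMeasure_of_tendsto_ae (fun _ => aestronglyMeasurable_const) (ae_of_all _ fun _ => hc))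
    (fun _ => aemeasurable_const)
  have h3 := ProbabilityMeasure.tendsto_iff_tendsto_charFun.1 h2.tendsto 1
  refine h3.trans_eq ?_
  congr 1
  change charFun ((gaussianReal 0 Var[f; μ].toNNReal).map fun x => c₀ * x) 1 = _
  rw [charFun_map_mul, charFun_gaussianReal]
  congr 1
  rw [Real.coe_toNNReal _ (variance_nonneg _ _)]
  push_cast
  ring

variable [IsProbabilityMeasure μ] {𝒴 : Type*} [MeasurableSpace 𝒴] {ν : Measure 𝒴}
  [IsProbabilityMeasure ν]
  {U : ℕ → Ω → 𝒴}

/-- **Central limit theorem** for a combination of the empirical processes of two independent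
samples, in the multivariate case. -/
theorem tendstoInDistribution_empProc_add {q : ℕ} (hX : ∀ i, Measurable (X i))
    (hXlaw : ∀ i, P.map (X i) = μ) (hXindep : iIndepFun X P) (hU : ∀ i, Measurable (U i))
    (hUlaw : ∀ i, P.map (U i) = ν) (hUindep : iIndepFun U P)
    (hindep : IndepFun (fun a i => X i a) (fun a j => U j a) P)
    {u : 𝒳 → Vec q} (hu : Measurable u) (hu2 : MemLp u 2 μ)
    {v : 𝒴 → Vec q} (hv : Measurable v) (hv2 : MemLp v 2 ν)
    {n N : ℕ → ℕ} (hn : Tendsto n atTop atTop) (hN : Tendsto N atTop atTop)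
    {c : ℕ → ℝ} {c₀ : ℝ} (hc : Tendsto c atTop (𝓝 c₀))
    {S : Matrix (Fin q) (Fin q) ℝ} (hS : S.PosSemidef)
    (hSq : ∀ t : Vec q, t ⬝ᵥ S.mulVec t =
      Var[fun x => ⟪t, u x⟫; μ] + c₀ ^ 2 * Var[fun y => ⟪t, v y⟫; ν]) :
    TendstoInDistribution
      (fun k a => empProc μ X (n k) u a + c k • empProc ν U (N k) v a) atTop
      (id : Vec q → Vec q) (fun _ => P) (multivariateGaussian 0 S) := by
  have hm1 : ∀ k, Measurable (empProc μ X (n k) u) := fun k => measurable_empProc hX hu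
  have hm2 : ∀ k, Measurable fun a => c k • empProc ν U (N k) v a := fun k =>
    Measurable.fun_const_smul (measurable_empProc hU hv) (c k)
  have hind : ∀ k, IndepFun (empProc μ X (n k) u) (fun a => c k • empProc ν U (N k) v a) P := by
    intro k
    -- Each empirical process is a measurable function of its whole sample sequence, namely the
    -- process built on the coordinate maps; independence of the two sequences then passes to it.
    have e1 : Measurable fun s : ℕ → 𝒳 => empProc μ (fun i (s : ℕ → 𝒳) => s i) (n k) u s :=
      measurable_empProc (fun i => measurable_pi_apply i) hu
    have e2 : Measurable fun s : ℕ → 𝒴 => c k • empProc ν (fun i (s : ℕ → 𝒴) => s i) (N k) v s :=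
      Measurable.fun_const_smul (measurable_empProc (fun i => measurable_pi_apply i) hv) (c k)
    exact hindep.comp e1 e2
  refine ⟨fun k => ((hm1 k).add (hm2 k)).aemeasurable, aemeasurable_id,
    ProbabilityMeasure.tendsto_of_tendsto_charFun fun t => ?_⟩
  have hui : Integrable u μ := hu2.integrable (by norm_num)
  have hvi : Integrable v ν := hv2.integrable (by norm_num)
  have hum : Measurable fun x => ⟪t, u x⟫ := by fun_prop
  have hvm : Measurable fun x => ⟪t, v x⟫ := by fun_prop
  have t1 := tendsto_charFun_const_mul_empProc hX hXlaw hXindep hum (hu2.const_inner t) hn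
    (c := fun _ => 1) tendsto_const_nhds
  have t2 := tendsto_charFun_const_mul_empProc hU hUlaw hUindep hvm (hv2.const_inner t) hN hc
  have t3 := t1.mul t2
  rw [← Complex.exp_add] at t3
  simp only [Measure.map_id, ProbabilityMeasure.coe_mk]
  rw [charFun_multivariateGaussian hS]
  convert t3 using 2 with k
  · rw [(hind _).charFun_map_fun_add_eq_mul (hm1 _).aemeasurable (hm2 _).aemeasurable]
    rw [Pi.mul_apply, charFun_map_eq_charFun_map_inner (hm1 _), charFun_map_eq_charFun_map_inner (hm2 _)]
    have i1 : ∀ a, ⟪t, empProc μ X (n k) u a⟫ = 1 * empProc μ X (n k) (fun x => ⟪t, u x⟫) a :=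
      fun a => by rw [one_mul]; exact (empProc_clm (innerSL ℝ t) hui a).symm
    have i2 : ∀ a, ⟪t, c k • empProc ν U (N k) v a⟫ =
        c k * empProc ν U (N k) (fun x => ⟪t, v x⟫) a :=
      fun a => by
        rw [inner_smul_right]
        congr 1
        exact (empProc_clm (innerSL ℝ t) hvi a).symm
    simp_rw [i1, i2]
  · congr 1
    rw [hSq]
    simp
    ring

end clt

/-! ### Consistency and asymptotic linearity of estimators solving an equation -/

/-! ### Moment bounds for the empirical process -/

section moments

variable {Ω 𝒳 : Type*} [MeasurableSpace Ω] [MeasurableSpace 𝒳] {P : Measure Ω}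
  [IsProbabilityMeasure P] {μ : Measure 𝒳} {X : ℕ → Ω → 𝒳}

lemma integral_sq_empProc_le (hX : ∀ i, Measurable (X i)) (hlaw : ∀ i, P.map (X i) = μ)
    (hindep : iIndepFun X P) {f : 𝒳 → ℝ} (hf : Measurable f) (hf2 : MemLp f 2 μ) (n : ℕ) :
    Integrable (fun a => empProc μ X n f a ^ 2) P ∧
      ∫ a, empProc μ X n f a ^ 2 ∂P ≤ Var[f; μ] := by
  set Y : ℕ → Ω → ℝ := fun i a => f (X i a) with hY
  have hL2 : ∀ i, MemLp (Y i) 2 P := fun i => by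
    rw [← hlaw i] at hf2
    exact hf2.comp_of_map (hX i).aemeasurable
  have hvar : ∀ i, Var[Y i; P] = Var[f; μ] := fun i => by
    rw [← hlaw i, variance_map hf.aemeasurable (hX i).aemeasurable]
    rfl
  have hmean : ∀ i, ∫ a, Y i a ∂P = ∫ x, f x ∂μ := fun i => by
    rw [← hlaw i, integral_map (hX i).aemeasurable hf.aestronglyMeasurable]
  set Z : Ω → ℝ := ∑ i ∈ Finset.range n, Y i with hZ
  have hZ2 : MemLp Z 2 P := memLp_finsetSum' _ fun i _ => hL2 i
  have hZvar : Var[Z; P] = n * Var[f; μ] := by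
    rw [hZ, IndepFun.variance_sum (fun i _ => hL2 i) fun i _ j _ hij =>
      (hindep.indepFun hij).comp hf hf]
    simp [hvar]
  have hZmean : ∫ a, Z a ∂P = n * ∫ x, f x ∂μ := by
    simp only [hZ, Finset.sum_apply]
    rw [integral_finsetSum _ fun i _ => (hL2 i).integrable (by norm_num)]
    simp [hmean]
  have heq : ∀ a, empProc μ X n f a ^ 2 = (n : ℝ)⁻¹ * (Z a - ∫ a, Z a ∂P) ^ 2 := fun a => by
    rw [hZmean, empProc, smul_eq_mul, mul_pow, inv_pow, Real.sq_sqrt (Nat.cast_nonneg n)]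
    simp [hZ, hY]
  have hi : Integrable (fun a => (Z a - ∫ a, Z a ∂P) ^ 2) P :=
    (hZ2.sub (memLp_const _)).integrable_sq
  simp_rw [heq]
  refine ⟨hi.const_mul _, ?_⟩
  rw [integral_const_mul, ← variance_eq_integral hZ2.aestronglyMeasurable.aemeasurable, hZvar,
    ← mul_assoc]
  rcases eq_or_ne n 0 with rfl | hn
  · simp [variance_nonneg]
  · rw [inv_mul_cancel₀ (by exact_mod_cast hn), one_mul]

/-- The variance of the empirical process does not grow with `n`, and |x| ≤ 1 + x² in each
coordinate. The uniform first moment supplies tightness through Markov's inequality. -/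
lemma exists_lintegral_enorm_empProc_le (hX : ∀ i, Measurable (X i))
    (hlaw : ∀ i, P.map (X i) = μ) (hindep : iIndepFun X P) {q : ℕ} {u : 𝒳 → Vec q}
    (hu : Measurable u) (hu2 : MemLp u 2 μ) (hui : Integrable u μ) :
    ∃ C : ℝ, 0 ≤ C ∧ ∀ n, ∫⁻ a, ‖empProc μ X n u a‖ₑ ∂P ≤ ENNReal.ofReal C := by
  have hum : ∀ j, Measurable fun x => u x j := fun j =>
    (EuclideanSpace.proj (𝕜 := ℝ) j).continuous.measurable.comp hu
  have huL : ∀ j, MemLp (fun x => u x j) 2 μ := fun j =>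
    hu2.continuousLinearMap_comp (EuclideanSpace.proj (𝕜 := ℝ) j)
  have h0 : ∀ j, 0 ≤ Var[fun x => u x j; μ] := fun j => variance_nonneg _ _
  refine ⟨∑ j, (1 + Var[fun x => u x j; μ]),
    Finset.sum_nonneg fun j _ => add_nonneg zero_le_one (h0 j), fun n => ?_⟩
  have hm : ∀ j, Measurable (empProc μ X n fun x => u x j) := fun j => measurable_empProc hX (hum j)
  calc _ ≤ ∫⁻ a, ∑ j, ENNReal.ofReal |empProc μ X n (fun x => u x j) a| ∂P := by
        refine lintegral_mono fun a => (enorm_le_sum_ofReal_abs _).trans_eq ?_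
        exact Finset.sum_congr rfl fun j _ => by rw [empProc_apply hui]
    _ = ∑ j, ∫⁻ a, ENNReal.ofReal |empProc μ X n (fun x => u x j) a| ∂P :=
        lintegral_finsetSum _ fun j _ => by have := hm j; fun_prop
    _ ≤ ∑ j, ENNReal.ofReal (1 + Var[fun x => u x j; μ]) := by
        refine Finset.sum_le_sum fun j _ => ?_
        obtain ⟨hi, hle⟩ := integral_sq_empProc_le hX hlaw hindep (hum j) (huL j) n
        calc _ ≤ ∫⁻ a, ENNReal.ofReal (1 + empProc μ X n (fun x => u x j) a ^ 2) ∂P := by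
              refine lintegral_mono fun a => ENNReal.ofReal_le_ofReal ?_
              rw [← sq_abs]
              nlinarith [sq_nonneg (|empProc μ X n (fun x => u x j) a| - 1)]
          _ = ENNReal.ofReal (∫ a, (1 + empProc μ X n (fun x => u x j) a ^ 2) ∂P) :=
              (ofReal_integral_eq_lintegral_ofReal ((integrable_const _).add hi)
                (ae_of_all _ fun a => add_nonneg zero_le_one (sq_nonneg _))).symm
          _ ≤ _ := by
              refine ENNReal.ofReal_le_ofReal ?_
              rw [integral_add (integrable_const _) hi]
              simpa using hle
    _ = _ := (ENNReal.ofReal_sum_of_nonneg fun j _ => add_nonneg zero_le_one (h0 j)).symm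

end moments

/-! ### Abstract Z-estimators -/

section zEstimator

variable {Ω : Type*} [MeasurableSpace Ω] {P : Measure Ω}
  {T E : Type*} [NormedAddCommGroup T] [NormedAddCommGroup E]

/-- **Consistency** of solutions of an estimating equation that converges uniformly in
probability to a function with a well-separated zero. -/
theorem tendstoInMeasure_of_uniform {Ψ : ℕ → Ω → T → E} {m : T → E} {K : Set T} {t₀ : T}
    (hK : IsCompact K) (hm : ContinuousOn m K) (huniq : ∀ t ∈ K, m t = 0 → t = t₀)
    {D : ℕ → Ω → ℝ} (hD : TendstoInMeasure P D atTop fun _ => 0)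
    (hΨ : ∀ k, ∀ᵐ a ∂P, ∀ t ∈ K, ‖Ψ k a t - m t‖ ≤ D k a)
    {B : ℕ → Set Ω} (hB : Tendsto (fun k => P (B k)) atTop (𝓝 0)) {est : ℕ → Ω → T}
    (hest : ∀ k, ∀ᵐ a ∂P, a ∉ B k → est k a ∈ K ∧ Ψ k a (est k a) = 0) :
    TendstoInMeasure P est atTop fun _ => t₀ := by
  rw [tendstoInMeasure_iff_norm] at hD ⊢
  intro ε hε
  have hK' : IsCompact (K ∩ {t | ε ≤ ‖t - t₀‖}) :=
    hK.inter_right (isClosed_le continuous_const (by fun_prop))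
  -- The zero is well separated: `‖m‖` attains a positive minimum on the compact set of points at
  -- distance at least ε. A solution lying there forces D ≥ η.
  obtain ⟨η, hη, hηm⟩ : ∃ η > 0, ∀ t ∈ K ∩ {t | ε ≤ ‖t - t₀‖}, η ≤ ‖m t‖ := by
    rcases (K ∩ {t | ε ≤ ‖t - t₀‖}).eq_empty_or_nonempty with h | h
    · exact ⟨1, one_pos, by simp [h]⟩
    · obtain ⟨t, ht, hmin⟩ := hK'.exists_isMinOn h (hm.mono Set.inter_subset_left).norm
      refine ⟨‖m t‖, norm_pos_iff.2 fun h0 => ?_, fun s hs => hmin hs⟩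
      have := ht.2
      rw [huniq t ht.1 h0] at this
      simp at this
      linarith
  have hsum := hB.add (hD η hη)
  rw [add_zero] at hsum
  refine tendsto_of_tendsto_of_tendsto_of_le_of_le tendsto_const_nhds hsum
    (fun _ => zero_le) fun k => ?_
  refine (measure_mono_ae ?_).trans (measure_union_le _ _)
  filter_upwards [hΨ k, hest k] with a h1 h2 ha
  by_cases haB : a ∈ B k
  · exact Or.inl haB
  · obtain ⟨he, h0⟩ := h2 haB
    refine Or.inr ?_
    have h3 := h1 _ he
    rw [h0, zero_sub, norm_neg] at h3
    change η ≤ ‖D k a - 0‖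
    rw [sub_zero]
    exact (hηm _ ⟨he, ha⟩).trans (h3.trans (Real.le_norm_self _))

variable [NormedSpace ℝ T] [NormedSpace ℝ E]

/-- **Asymptotic linearity** of a consistent solution of an estimating equation that is
stochastically equicontinuous at the limit. -/
theorem asymptotic_linearity {Ψ : ℕ → Ω → T → E} {m : T → E} {t₀ : T} {A : T →L[ℝ] E}
    {A' : E →L[ℝ] T} (hA : ∀ t, A' (A t) = t) (hm : HasFDerivAt m A t₀) (hm0 : m t₀ = 0)
    {s : ℕ → ℝ} (hs : ∀ k, 0 ≤ s k)
    {W : ℕ → Ω → E} {C₁ : ℝ} (hC₁ : 0 ≤ C₁) (hWm : ∀ k, AEMeasurable (fun a => ‖W k a‖ₑ) P)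
    (hW : ∀ᶠ k in atTop, ∫⁻ a, ‖W k a‖ₑ ∂P ≤ ENNReal.ofReal C₁)
    {C₂ δ₀ : ℝ} (hC₂ : 0 ≤ C₂) (hδ₀ : 0 < δ₀)
    (hequi : ∀ δ > 0, δ < δ₀ → ∀ᶠ k in atTop, ∃ D : Ω → ℝ≥0∞, Measurable D ∧
      ∫⁻ a, D a ∂P ≤ ENNReal.ofReal (C₂ * δ) ∧
      ∀ᵐ a ∂P, ∀ t ∈ Metric.closedBall t₀ δ, ‖s k • (Ψ k a t - m t) - W k a‖ₑ ≤ D a)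
    {B : ℕ → Set Ω} (hB : Tendsto (fun k => P (B k)) atTop (𝓝 0)) {est : ℕ → Ω → T}
    (hest : ∀ k, ∀ᵐ a ∂P, a ∉ B k → Ψ k a (est k a) = 0)
    (hcons : TendstoInMeasure P est atTop fun _ => t₀) :
    TendstoInMeasure P (fun k a => s k • (est k a - t₀) + A' (W k a)) atTop fun _ => 0 := by
  rw [tendstoInMeasure_iff_norm] at hcons ⊢
  intro ε hε
  rw [ENNReal.tendsto_nhds_zero]
  intro κ hκ
  -- Four exceptional events will each get probability at most κ/4; `κ'` is a real substitute for
  -- κ/4, since κ may be infinite.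
  obtain ⟨κ', hκ', hκκ⟩ : ∃ κ' : ℝ, 0 < κ' ∧ ENNReal.ofReal κ' ≤ κ / 4 := by
    have h4 : 0 < κ / 4 := ENNReal.div_pos hκ.ne' (by norm_num)
    obtain ⟨z, hz0, hz⟩ := ENNReal.lt_iff_exists_nnreal_btwn.1 h4
    exact ⟨z, by exact_mod_cast hz0, by simpa using hz.le⟩
  set α : ℝ := ‖A'‖ + 1 with hα
  have hα0 : 0 < α := by positivity
  -- `η` is the linearisation error. The first bound lets the remainder be absorbed; the second is
  -- Markov's inequality for `‖W k‖` at level `w₁`.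
  obtain ⟨η, hη0, hη1, hη2⟩ : ∃ η : ℝ, 0 < η ∧ α * η ≤ 1 / 2 ∧ C₁ * (4 * α ^ 2 * η) ≤ κ' * ε := by
    refine ⟨min (1 / (2 * α)) (κ' * ε / (4 * α ^ 2 * (C₁ + 1))), by positivity, ?_, ?_⟩
    · calc _ ≤ α * (1 / (2 * α)) := by gcongr; exact min_le_left _ _
        _ = _ := by field_simp
    · calc _ ≤ (C₁ + 1) * (4 * α ^ 2 * (κ' * ε / (4 * α ^ 2 * (C₁ + 1)))) := by
            gcongr
            · linarith
            · exact min_le_right _ _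
        _ = _ := by field_simp
  obtain ⟨δ₁, hδ₁, hder⟩ : ∃ δ₁ > 0, ∀ t, ‖t - t₀‖ < δ₁ →
      ‖m t - A (t - t₀)‖ ≤ η * ‖t - t₀‖ := by
    have h := hm.isLittleO.def hη0
    rw [Metric.eventually_nhds_iff] at h
    obtain ⟨δ₁, hδ₁, h⟩ := h
    refine ⟨δ₁, hδ₁, fun t ht => ?_⟩
    have := h (y := t) (by rwa [dist_eq_norm])
    rwa [hm0, sub_zero] at this
  -- The last condition is Markov's inequality for the oscillation majorant `D` at level `w₂`.
  obtain ⟨δ, hδ, hδδ₀, hδδ₁, hδκ⟩ : ∃ δ > 0, δ < δ₀ ∧ δ ≤ δ₁ ∧ C₂ * δ * (4 * α) ≤ κ' * ε := by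
    refine ⟨min (min (δ₀ / 2) δ₁) (κ' * ε / (4 * α * (C₂ + 1))), by positivity, ?_, ?_, ?_⟩
    · exact ((min_le_left _ _).trans (min_le_left _ _)).trans_lt (by linarith)
    · exact (min_le_left _ _).trans (min_le_right _ _)
    · calc _ ≤ (C₂ + 1) * (κ' * ε / (4 * α * (C₂ + 1))) * (4 * α) := by
            gcongr
            · linarith
            · exact min_le_right _ _
        _ = _ := by field_simp
  have hκ4 : 0 < κ / 4 := ENNReal.div_pos hκ.ne' (by norm_num)
  filter_upwards [hW, hequi δ hδ hδδ₀, (ENNReal.tendsto_nhds_zero.1 hB) _ hκ4,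
    (ENNReal.tendsto_nhds_zero.1 (hcons δ hδ)) _ hκ4] with k hWk ⟨D, hDm, hDi, hD⟩ hBk hck
  -- The levels are chosen so that α²η w₁ = α w₂ = ε/4.
  set w₁ : ℝ := ε / (4 * α ^ 2 * η) with hw₁
  set w₂ : ℝ := ε / (4 * α) with hw₂
  have hw₁0 : 0 < w₁ := by positivity
  have hw₂0 : 0 < w₂ := by positivity
  have hM1 : P {a | ENNReal.ofReal w₁ ≤ ‖W k a‖ₑ} ≤ κ / 4 := by
    refine (meas_ge_le_lintegral_div (hWm k) (by simpa using hw₁0)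
      ENNReal.ofReal_ne_top).trans (le_trans ?_ hκκ)
    refine (ENNReal.div_le_div_right hWk _).trans ?_
    rw [← ENNReal.ofReal_div_of_pos hw₁0]
    refine ENNReal.ofReal_le_ofReal ?_
    rw [div_le_iff₀ hw₁0, hw₁, ← mul_div_assoc, le_div_iff₀ (by positivity)]
    exact hη2
  have hM2 : P {a | ENNReal.ofReal w₂ ≤ D a} ≤ κ / 4 := by
    refine (meas_ge_le_lintegral_div hDm.aemeasurable (by simpa using hw₂0)
      ENNReal.ofReal_ne_top).trans (le_trans ?_ hκκ)
    refine (ENNReal.div_le_div_right hDi _).trans ?_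
    rw [← ENNReal.ofReal_div_of_pos hw₂0]
    refine ENNReal.ofReal_le_ofReal ?_
    rw [div_le_iff₀ hw₂0, hw₂, ← mul_div_assoc, le_div_iff₀ (by positivity)]
    exact hδκ
  have hcover : {a | ε ≤ ‖s k • (est k a - t₀) + A' (W k a) - 0‖} ≤ᵐ[P]
      ((B k ∪ {a | δ ≤ ‖est k a - t₀‖}) ∪
        ({a | ENNReal.ofReal w₁ ≤ ‖W k a‖ₑ} ∪ {a | ENNReal.ofReal w₂ ≤ D a}) : Set Ω) := by
    filter_upwards [hD, hest k] with a hDa hea ha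
    by_contra hcon
    change ¬ ((a ∈ B k ∨ δ ≤ ‖est k a - t₀‖) ∨
      (ENNReal.ofReal w₁ ≤ ‖W k a‖ₑ ∨ ENNReal.ofReal w₂ ≤ D a)) at hcon
    push Not at hcon
    obtain ⟨⟨haB, haδ⟩, haW, haD⟩ := hcon
    change ε ≤ ‖s k • (est k a - t₀) + A' (W k a) - 0‖ at ha
    rw [sub_zero] at ha
    set t := est k a with ht
    have h1 : ‖s k • m t + W k a‖ < w₂ := by
      have h := (hDa t (by rw [Metric.mem_closedBall, dist_eq_norm]; exact haδ.le)).trans_lt haD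
      rw [hea haB, zero_sub, smul_neg, ← neg_add', enorm_neg, ← ofReal_norm,
        ENNReal.ofReal_lt_ofReal_iff hw₂0] at h
      exact h
    have hWa : ‖W k a‖ < w₁ := by
      rwa [← ofReal_norm, ENNReal.ofReal_lt_ofReal_iff hw₁0] at haW
    set x := s k • (t - t₀) with hx
    have h2 : ‖s k • m t - A x‖ ≤ η * ‖x‖ := by
      rw [hx, map_smul, ← smul_sub, norm_smul, norm_smul, Real.norm_of_nonneg (hs k)]
      have := mul_le_mul_of_nonneg_left (hder t (haδ.trans_le hδδ₁)) (hs k)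
      linarith
    have h3 : ‖A x + W k a‖ ≤ w₂ + η * ‖x‖ := by
      calc ‖A x + W k a‖ = ‖(s k • m t + W k a) - (s k • m t - A x)‖ := by congr 1; abel
        _ ≤ _ := (norm_sub_le _ _).trans (add_le_add h1.le h2)
    set y := ‖x + A' (W k a)‖ with hy
    have h4 : y ≤ α * (w₂ + η * ‖x‖) := by
      have : x + A' (W k a) = A' (A x + W k a) := by rw [map_add, hA]
      rw [hy, this]
      refine (A'.le_opNorm _).trans ?_
      gcongr
      linarith
    have h5 : ‖x‖ ≤ y + α * ‖W k a‖ := by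
      calc ‖x‖ = ‖(x + A' (W k a)) - A' (W k a)‖ := by congr 1; abel
        _ ≤ y + ‖A' (W k a)‖ := norm_sub_le _ _
        _ ≤ _ := by
          gcongr
          refine (A'.le_opNorm _).trans ?_
          gcongr
          linarith
    -- Half of the remainder `y` is absorbed into the left side, leaving y/2 < ε/4 + ε/4. No prior
    -- √n-rate for the estimator is needed.
    have h6 : α * η * ‖x‖ ≤ 1 / 2 * y + α ^ 2 * η * ‖W k a‖ := by
      have e1 := mul_le_mul_of_nonneg_left h5 (mul_pos hα0 hη0).le
      have e2 : α * η * y ≤ 1 / 2 * y := by gcongr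
      nlinarith
    have h7 : α ^ 2 * η * ‖W k a‖ < ε / 4 := by
      have : α ^ 2 * η * w₁ = ε / 4 := by rw [hw₁]; field_simp
      rw [← this]
      gcongr
    have h8 : α * w₂ = ε / 4 := by rw [hw₂]; field_simp
    nlinarith
  calc _ ≤ P ((B k ∪ {a | δ ≤ ‖est k a - t₀‖}) ∪
        ({a | ENNReal.ofReal w₁ ≤ ‖W k a‖ₑ} ∪ {a | ENNReal.ofReal w₂ ≤ D a})) :=
        measure_mono_ae hcover
    _ ≤ (κ / 4 + κ / 4) + (κ / 4 + κ / 4) :=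
        (measure_union_le _ _).trans (add_le_add ((measure_union_le _ _).trans (add_le_add hBk hck))
          ((measure_union_le _ _).trans (add_le_add hM1 hM2)))
    _ = κ := by
        rw [show κ / 4 + κ / 4 + (κ / 4 + κ / 4) = 4 * (κ / 4) by ring]
        exact ENNReal.mul_div_cancel (by norm_num) (by norm_num)

end zEstimator

/-! ### The estimating function and its covariance -/

/-! ### Differentiation under the integral sign -/

section differentiation

/-- **Differentiation under the integral** at a point where the integrand is almost surely
differentiable and Lipschitz around it with an integrable factor. -/
lemma fderiv_integral_of_lipschitz {𝒳 : Type*} [MeasurableSpace 𝒳] {μ : Measure 𝒳}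
    {T E : Type*} [NormedAddCommGroup T] [NormedSpace ℝ T] [FiniteDimensional ℝ T]
    [NormedAddCommGroup E] [NormedSpace ℝ E]
    {g : T → 𝒳 → E} (hg : ∀ t, AEStronglyMeasurable (g t) μ) {t₀ : T} {r : ℝ}
    (hr : 0 < r) (hgi : Integrable (g t₀) μ) {φ : 𝒳 → ℝ} (hφ : Integrable φ μ)
    (hLip : ∀ᵐ x ∂μ, ∀ t ∈ Metric.ball t₀ r, ‖g t x - g t₀ x‖ ≤ φ x * ‖t - t₀‖)
    (hd : ∀ᵐ x ∂μ, DifferentiableAt ℝ (fun t => g t x) t₀) :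
    Integrable (fun x => fderiv ℝ (fun t => g t x) t₀) μ ∧
      HasFDerivAt (fun t => ∫ x, g t x ∂μ) (∫ x, fderiv ℝ (fun t => g t x) t₀ ∂μ) t₀ := by
  -- Directional derivatives are limits of difference quotients, hence measurable; a finite basis
  -- then recovers the whole derivative.
  have happly : ∀ v, AEStronglyMeasurable (fun x => fderiv ℝ (fun t => g t x) t₀ v) μ := by
    intro v
    refine aestronglyMeasurable_of_tendsto_ae atTop
      (f := fun (n : ℕ) x => (n : ℝ) • (g (t₀ + (n : ℝ)⁻¹ • v) x - g t₀ x))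
      (fun n => ((hg _).sub (hg _)).const_smul _) ?_
    filter_upwards [hd] with x hx
    exact (hx.hasFDerivAt.lim_real v).comp tendsto_natCast_atTop_atTop
  set b := Module.finBasis ℝ T with hb
  have hmeas : AEStronglyMeasurable (fun x => fderiv ℝ (fun t => g t x) t₀) μ := by
    have heq : ∀ L : T →L[ℝ] E,
        L = ∑ i, ContinuousLinearMap.smulRightL ℝ T E
          (LinearMap.toContinuousLinearMap (b.coord i)) (L (b i)) := by
      intro L
      ext t
      conv_lhs => rw [← b.sum_repr t, map_sum]
      simp
    have : (fun x => fderiv ℝ (fun t => g t x) t₀) = fun x => ∑ i,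
        ContinuousLinearMap.smulRightL ℝ T E (LinearMap.toContinuousLinearMap (b.coord i))
          (fderiv ℝ (fun t => g t x) t₀ (b i)) := funext fun x => heq _
    rw [this]
    exact Finset.aestronglyMeasurable_fun_sum _ fun i _ =>
      (ContinuousLinearMap.continuous _).comp_aestronglyMeasurable (happly (b i))
  exact hasFDerivAt_integral_of_dominated_loc_of_lip' (Metric.ball_mem_nhds t₀ hr)
    (fun t _ => hg t) hgi hmeas hLip hφ (hd.mono fun x hx => hx.hasFDerivAt)

end differentiation

section quadraticForm

variable {𝒳 : Type*} [MeasurableSpace 𝒳] {μ : Measure 𝒳} {q : ℕ}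

lemma measurable_apply {u : 𝒳 → Vec q} (hu : Measurable u) (j : Fin q) :
    Measurable fun x => u x j :=
  (EuclideanSpace.proj (𝕜 := ℝ) j).continuous.measurable.comp hu

lemma memLp_apply {p : ℝ≥0∞} {u : 𝒳 → Vec q} (hu : MemLp u p μ) (j : Fin q) :
    MemLp (fun x => u x j) p μ :=
  hu.continuousLinearMap_comp (EuclideanSpace.proj (𝕜 := ℝ) j)

lemma inner_eq_sum (t v : Vec q) : ⟪t, v⟫ = ∑ j, t j * v j := by
  simp [PiLp.inner_apply, mul_comm]

lemma variance_inner_eq_sum [IsProbabilityMeasure μ] {u : 𝒳 → Vec q} (hu2 : MemLp u 2 μ) (t : Vec q) :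
    Var[fun x => ⟪t, u x⟫; μ] =
      ∑ j, ∑ k, t j * t k * cov[fun x => u x j, fun x => u x k; μ] := by
  have hm : AEMeasurable (fun x => ⟪t, u x⟫) μ := (hu2.const_inner t).aestronglyMeasurable.aemeasurable
  rw [← covariance_self hm]
  simp_rw [inner_eq_sum]
  rw [covariance_fun_sum_fun_sum (fun j => (memLp_apply hu2 j).const_mul _)
    (fun j => (memLp_apply hu2 j).const_mul _)]
  refine Finset.sum_congr rfl fun j _ => Finset.sum_congr rfl fun k _ => ?_
  rw [covariance_const_mul_left, covariance_const_mul_right]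
  ring

end quadraticForm

/-! ### Labeled and unlabeled scores, and the covariance V -/

section model

variable {d q : ℕ} {𝒵 : Type*}

/-- Multiplication by `diag(w)` as a continuous linear map. -/
def diagCLM (w : Fin q → ℝ) : Vec q →L[ℝ] Vec q :=
  Matrix.toEuclideanCLM (𝕜 := ℝ) (Matrix.diagonal w)

lemma diagCLM_apply (w : Fin q → ℝ) (v : Vec q) : diagCLM w v = diagMul w v := by
  ext j
  simp [diagCLM, diagMul, Matrix.mulVec_diagonal]

/-- The contribution of a labeled point to the estimating function. -/
def labScore (ψ : ℝ → Vec d → Vec q → Vec q) (f : 𝒵 → ℝ) (w : Fin q → ℝ) (θ : Vec q)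
    (p : ℝ × Vec d × 𝒵) : Vec q :=
  trueScore ψ θ p - diagMul w (predScore ψ f θ p.2)

/-- The contribution of an unlabeled point to the estimating function. -/
def unlScore (ψ : ℝ → Vec d → Vec q → Vec q) (f : 𝒵 → ℝ) (w : Fin q → ℝ) (θ : Vec q)
    (u : Vec d × 𝒵) : Vec q :=
  diagMul w (predScore ψ f θ u)

variable {ψ : ℝ → Vec d → Vec q → Vec q} {f : 𝒵 → ℝ} {w : Fin q → ℝ}

lemma estFun_eq (n N : ℕ) (lab : ℕ → ℝ × Vec d × 𝒵) (unl : ℕ → Vec d × 𝒵) (θ : Vec q) :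
    estFun ψ f w n N lab unl θ =
      (n : ℝ)⁻¹ • ∑ i ∈ Finset.range n, labScore ψ f w θ (lab i) +
        (N : ℝ)⁻¹ • ∑ j ∈ Finset.range N, unlScore ψ f w θ (unl j) := by
  simp only [estFun, labScore, unlScore, ← diagCLM_apply, map_add, map_neg, map_smul, map_sum,
    Finset.sum_sub_distrib, smul_sub]
  abel

variable [MeasurableSpace 𝒵] {π : Measure (ℝ × Vec d × 𝒵)}

lemma measurable_trueScore (hψ : ∀ θ, Measurable (fun p : ℝ × Vec d => ψ p.1 p.2 θ))
    (θ : Vec q) : Measurable (trueScore ψ θ : ℝ × Vec d × 𝒵 → Vec q) :=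
  (hψ θ).comp (measurable_fst.prodMk measurable_snd.fst)

lemma measurable_predScore (hψ : ∀ θ, Measurable (fun p : ℝ × Vec d => ψ p.1 p.2 θ))
    (hf : Measurable f) (θ : Vec q) : Measurable (predScore ψ f θ) :=
  (hψ θ).comp ((hf.comp measurable_snd).prodMk measurable_fst)

lemma measurable_unlScore (hψ : ∀ θ, Measurable (fun p : ℝ × Vec d => ψ p.1 p.2 θ))
    (hf : Measurable f) (θ : Vec q) : Measurable (unlScore ψ f w θ) := by
  have : unlScore ψ f w θ = fun u => diagCLM w (predScore ψ f θ u) :=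
    funext fun u => (diagCLM_apply w _).symm
  rw [this]
  exact (diagCLM w).continuous.measurable.comp (measurable_predScore hψ hf θ)

lemma measurable_labScore (hψ : ∀ θ, Measurable (fun p : ℝ × Vec d => ψ p.1 p.2 θ))
    (hf : Measurable f) (θ : Vec q) : Measurable (labScore ψ f w θ) :=
  (measurable_trueScore hψ θ).sub ((measurable_unlScore hψ hf θ).comp measurable_snd)

lemma memLp_two_of_iSup {𝒳 T E : Type*} [MeasurableSpace 𝒳] {μ : Measure 𝒳}
    [NormedAddCommGroup E] {K : Set T} {g : T → 𝒳 → E}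
    (h : ⨆ t ∈ K, ∫⁻ x, ‖g t x‖ₑ ^ 2 ∂μ < ∞) {t : T} (ht : t ∈ K)
    (hg : AEStronglyMeasurable (g t) μ) : MemLp (g t) 2 μ := by
  refine ⟨hg, ?_⟩
  rw [eLpNorm_lt_top_iff_lintegral_rpow_enorm_lt_top (by norm_num) (by norm_num)]
  have := (le_iSup₂ (f := fun t (_ : t ∈ K) => ∫⁻ x, ‖g t x‖ₑ ^ 2 ∂μ) t ht).trans_lt h
  simpa using this

lemma integral_snd {u : Vec d × 𝒵 → Vec q} (hu : Measurable u) :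
    ∫ v, u v ∂π.snd = ∫ p, u p.2 ∂π :=
  integral_map measurable_snd.aemeasurable hu.aestronglyMeasurable

lemma memLp_two_snd {u : Vec d × 𝒵 → Vec q} (hu : Measurable u)
    (h : MemLp (fun p => u p.2) 2 π) : MemLp u 2 π.snd :=
  (memLp_map_measure_iff hu.aestronglyMeasurable measurable_snd.aemeasurable).2 h

lemma posSemidef_asympCov (A : Matrix (Fin q) (Fin q) ℝ) {θ : Vec q} {ρ : ℝ}
    (h : (V ψ f w π θ ρ).PosSemidef) : (asympCov ψ f w π θ ρ A).PosSemidef := by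
  have := h.mul_mul_conjTranspose_same A⁻¹
  rwa [Matrix.conjTranspose_eq_transpose_of_trivial] at this

variable [IsProbabilityMeasure π]

/-- Bilinearity of the covariance of `labScore` produces M₁, M₂ and the two M₄ terms. Square
integrability is required only after weighting; pulling out the weights needs none, so entries with
a vanishing weight play no role. -/
lemma V_apply (hψ : ∀ θ, Measurable (fun p : ℝ × Vec d => ψ p.1 p.2 θ)) (hf : Measurable f)
    {θ : Vec q} (ρ : ℝ) (h1 : MemLp (trueScore ψ θ) 2 π)
    (h2 : MemLp (fun p => unlScore ψ f w θ p.2) 2 π) (j k : Fin q) :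
    V ψ f w π θ ρ j k =
      cov[fun p => labScore ψ f w θ p j, fun p => labScore ψ f w θ p k; π] +
        ρ * cov[fun u => unlScore ψ f w θ u j, fun u => unlScore ψ f w θ u k; π.snd] := by
  have hp : ∀ j, Measurable fun u => predScore ψ f θ u j := fun j =>
    measurable_apply (measurable_predScore hψ hf θ) j
  have hM₃ : cov[fun u => predScore ψ f θ u j, fun u => predScore ψ f θ u k; π.snd] =
      cov[fun p => predScore ψ f θ p.2 j, fun p => predScore ψ f θ p.2 k; π] :=
    covariance_map_fun (hp j).aestronglyMeasurable (hp k).aestronglyMeasurable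
      measurable_snd.aemeasurable
  have hu : ∀ j, ∀ u, unlScore ψ f w θ u j = w j * predScore ψ f θ u j := fun _ _ => rfl
  have hl : ∀ j, (fun p => labScore ψ f w θ p j) =
      fun p => trueScore ψ θ p j - unlScore ψ f w θ p.2 j := fun _ => rfl
  rw [hl, hl, covariance_fun_sub_fun_sub (memLp_apply h1 j) (memLp_apply h2 j) (memLp_apply h1 k)
    (memLp_apply h2 k)]
  simp only [hu, covariance_const_mul_left, covariance_const_mul_right]
  simp only [V, M₁, M₂, M₃, M₄, Matrix.sub_apply, Matrix.add_apply, Matrix.mul_diagonal,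
    Matrix.diagonal_mul, Matrix.smul_apply, Matrix.of_apply, Matrix.transpose_apply, smul_eq_mul]
  rw [covariance_comm (fun p => predScore ψ f θ p.2 j) (fun p => trueScore ψ θ p k), hM₃]
  ring

lemma dotProduct_V_mulVec (hψ : ∀ θ, Measurable (fun p : ℝ × Vec d => ψ p.1 p.2 θ))
    (hf : Measurable f) {θ : Vec q} (ρ : ℝ) (h1 : MemLp (trueScore ψ θ) 2 π)
    (h2 : MemLp (fun p => unlScore ψ f w θ p.2) 2 π) (t : Vec q) :
    t ⬝ᵥ (V ψ f w π θ ρ).mulVec t =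
      Var[fun p => ⟪t, labScore ψ f w θ p⟫; π] + ρ * Var[fun u => ⟪t, unlScore ψ f w θ u⟫; π.snd] := by
  have hl : MemLp (labScore ψ f w θ) 2 π := h1.sub h2
  rw [variance_inner_eq_sum hl,
    variance_inner_eq_sum (memLp_two_snd (measurable_unlScore hψ hf θ) h2), Finset.mul_sum,
    ← Finset.sum_add_distrib]
  simp only [dotProduct, Matrix.mulVec, Finset.mul_sum]
  refine Finset.sum_congr rfl fun j _ => ?_
  rw [← Finset.sum_add_distrib]
  refine Finset.sum_congr rfl fun k _ => ?_
  rw [V_apply hψ hf ρ h1 h2]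
  ring

lemma posSemidef_V (hψ : ∀ θ, Measurable (fun p : ℝ × Vec d => ψ p.1 p.2 θ))
    (hf : Measurable f) {θ : Vec q} {ρ : ℝ} (hρ : 0 ≤ ρ) (h1 : MemLp (trueScore ψ θ) 2 π)
    (h2 : MemLp (fun p => unlScore ψ f w θ p.2) 2 π) : (V ψ f w π θ ρ).PosSemidef := by
  refine Matrix.PosSemidef.of_dotProduct_mulVec_nonneg ?_ fun t => ?_
  · ext j k
    simp only [Matrix.conjTranspose_apply, star_trivial]
    rw [V_apply hψ hf ρ h1 h2, V_apply hψ hf ρ h1 h2,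
      covariance_comm (fun p => labScore ψ f w θ p k),
      covariance_comm (fun u => unlScore ψ f w θ u k)]
  · have := dotProduct_V_mulVec hψ hf ρ h1 h2 (WithLp.toLp 2 t)
    rw [star_trivial]
    rw [show t ⬝ᵥ (V ψ f w π θ ρ).mulVec t = _ from this]
    exact add_nonneg (variance_nonneg _ _) (mul_nonneg hρ (variance_nonneg _ _))

/-- Move A⁻¹ across the inner product onto `t` and use the form of V; the minus sign disappears in
the variance. This is the shape that the central limit theorem for -A⁻¹ applied to the scores asks
for. -/
lemma dotProduct_asympCov_mulVec (hψ : ∀ θ, Measurable (fun p : ℝ × Vec d => ψ p.1 p.2 θ))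
    (hf : Measurable f) {θ : Vec q} (ρ : ℝ) (h1 : MemLp (trueScore ψ θ) 2 π)
    (h2 : MemLp (fun p => unlScore ψ f w θ p.2) 2 π) (A : Matrix (Fin q) (Fin q) ℝ) (t : Vec q) :
    t ⬝ᵥ (asympCov ψ f w π θ ρ A).mulVec t =
      Var[fun p => ⟪t, -Matrix.toEuclideanCLM (𝕜 := ℝ) A⁻¹ (labScore ψ f w θ p)⟫; π] +
        ρ * Var[fun u => ⟪t, -Matrix.toEuclideanCLM (𝕜 := ℝ) A⁻¹ (unlScore ψ f w θ u)⟫; π.snd] := by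
  set s : Vec q := WithLp.toLp 2 (A⁻¹.transpose.mulVec t) with hs
  have hinner : ∀ v : Vec q, ⟪t, -Matrix.toEuclideanCLM (𝕜 := ℝ) A⁻¹ v⟫ = -⟪s, v⟫ := fun v => by
    rw [inner_neg_right, Matrix.inner_toEuclideanCLM]
    congr 1
    rw [inner_eq_sum, Matrix.dotProduct_mulVec, hs, Matrix.mulVec_transpose]
    rfl
  have hq : t ⬝ᵥ (asympCov ψ f w π θ ρ A).mulVec t = s ⬝ᵥ (V ψ f w π θ ρ).mulVec s := by
    simp only [asympCov, hs, ← Matrix.mulVec_mulVec]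
    rw [Matrix.dotProduct_mulVec, Matrix.mulVec_transpose]
  rw [hq, dotProduct_V_mulVec hψ hf ρ h1 h2]
  simp_rw [hinner]
  rw [show (fun p => -⟪s, labScore ψ f w θ p⟫) = -fun p => ⟪s, labScore ψ f w θ p⟫ from rfl,
    show (fun u => -⟪s, unlScore ψ f w θ u⟫) = -fun u => ⟪s, unlScore ψ f w θ u⟫ from rfl,
    variance_neg, variance_neg]

/-- An integrable majorant of a function of the second component is also available as a function
of the second component. -/
lemma exists_integrable_majorant_snd {h : ℝ × Vec d × 𝒵 → ℝ} (hh : Integrable h π)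
    {R : Vec d × 𝒵 → ℝ → Prop} (hR : ∀ u c c', c ≤ c' → R u c → R u c')
    (hRh : ∀ᵐ p ∂π, R p.2 (h p)) :
    ∃ h' : Vec d × 𝒵 → ℝ, Integrable h' π.snd ∧ ∀ᵐ u ∂π.snd, R u (h' u) := by
  set k := hh.1.mk h with hk
  have hkm : Measurable k := hh.1.stronglyMeasurable_mk.measurable
  have hki : Integrable k π := hh.congr hh.1.ae_eq_mk
  obtain ⟨F, hFm, hFi, hF⟩ := exists_snd_majorant π (F := fun p => ‖k p‖ₑ) hkm.enorm
  have hfin : ∫⁻ u, F u ∂π.snd ≠ ∞ := by rw [hFi]; exact hki.2.ne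
  refine ⟨fun u => (F u).toReal, integrable_toReal_of_lintegral_ne_top hFm.aemeasurable hfin, ?_⟩
  have hRk : ∀ᵐ p ∂π, R p.2 (k p) := by
    filter_upwards [hRh, hh.1.ae_eq_mk] with p hp hpk
    rwa [hk, ← hpk]
  filter_upwards [hF _ hRk, ae_lt_top hFm hfin] with u ⟨y, hy, hyF⟩ hu
  refine hR _ _ _ ((Real.le_norm_self _).trans ?_) hy
  rw [← toReal_enorm]
  exact ENNReal.toReal_mono hu.ne hyF

/-- A square integrable majorant of a function of the second component is also available as a
function of the second component. -/
lemma exists_memLp_two_majorant_snd {φ : ℝ × Vec d × 𝒵 → ℝ} (hφ : MemLp φ 2 π)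
    {R : Vec d × 𝒵 → ℝ → Prop} (hR : ∀ u c c', c ≤ c' → R u c → R u c')
    (hRφ : ∀ᵐ p ∂π, R p.2 (φ p)) :
    ∃ φ' : Vec d × 𝒵 → ℝ, Measurable φ' ∧ (∀ u, 0 ≤ φ' u) ∧ MemLp φ' 2 π.snd ∧
      ∀ᵐ u ∂π.snd, R u (φ' u) := by
  -- The integrable case is applied to φ² and its majorant is square-rooted.
  obtain ⟨h, hh, hRh⟩ := exists_integrable_majorant_snd hφ.integrable_sq
    (R := fun u c => R u √c) (fun u c c' hcc => hR u _ _ (Real.sqrt_le_sqrt hcc))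
    (hRφ.mono fun p hp => hR _ _ _ (by rw [Real.sqrt_sq_eq_abs]; exact le_abs_self _) hp)
  set k := hh.1.mk h with hk
  have hkm : Measurable k := hh.1.stronglyMeasurable_mk.measurable
  have hki : Integrable k π.snd := hh.congr hh.1.ae_eq_mk
  refine ⟨fun u => √(k u), hkm.sqrt, fun u => Real.sqrt_nonneg _, ?_, ?_⟩
  · rw [memLp_two_iff_integrable_sq hkm.sqrt.aestronglyMeasurable]
    refine hki.norm.mono' (hkm.sqrt.pow_const 2).aestronglyMeasurable (ae_of_all _ fun u => ?_)
    rw [Real.norm_of_nonneg (sq_nonneg _), Real.sq_sqrt']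
    exact max_le (Real.le_norm_self _) (norm_nonneg _)
  · filter_upwards [hRh, hh.1.ae_eq_mk] with u hu huk
    rwa [hk, ← huk]

end model

/-! ### Consistency and asymptotic normality of the estimator -/

section main

lemma tendstoInMeasure_zero_add {Ω : Type*} [MeasurableSpace Ω] {P : Measure Ω}
    {D₁ D₂ : ℕ → Ω → ℝ} (h₁ : TendstoInMeasure P D₁ atTop fun _ => 0)
    (h₂ : TendstoInMeasure P D₂ atTop fun _ => 0) :
    TendstoInMeasure P (fun k a => D₁ k a + D₂ k a) atTop fun _ => 0 := by
  rw [tendstoInMeasure_iff_norm] at *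
  intro ε hε
  have h := (h₁ (ε / 2) (half_pos hε)).add (h₂ (ε / 2) (half_pos hε))
  rw [add_zero] at h
  refine tendsto_of_tendsto_of_tendsto_of_le_of_le tendsto_const_nhds h (fun _ => zero_le)
    fun k => (measure_mono fun a ha => ?_).trans (measure_union_le _ _)
  by_contra hcon
  simp only [Set.mem_union, Set.mem_ofPred_eq, sub_zero, not_or, not_le] at ha hcon
  linarith [norm_add_le (D₁ k a) (D₂ k a), hcon.1, hcon.2]

lemma integrable_of_lipschitz {𝒳 T E : Type*} [MeasurableSpace 𝒳] {μ : Measure 𝒳}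
    [NormedAddCommGroup T] [NormedAddCommGroup E] {g : T → 𝒳 → E} {φ : 𝒳 → ℝ}
    (hφ : Integrable φ μ) {t₀ t : T} (hg : AEStronglyMeasurable (g t) μ)
    (hgi : Integrable (g t₀) μ) (h : ∀ᵐ x ∂μ, ‖g t x - g t₀ x‖ ≤ φ x * ‖t - t₀‖) :
    Integrable (g t) μ := by
  have hd : Integrable (fun x => g t x - g t₀ x) μ :=
    (hφ.mul_const ‖t - t₀‖).mono' (hg.sub hgi.1) h
  refine (hd.add hgi).congr (ae_of_all _ fun x => ?_)
  simp

lemma smul_mean_sub_eq_empProc {Ω 𝒳 : Type*} {q : ℕ} [MeasurableSpace 𝒳] {μ : Measure 𝒳}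
    {X : ℕ → Ω → 𝒳} {m : ℕ} (hm : 0 < m) (u : 𝒳 → Vec q) (a : Ω) :
    √(m : ℝ) • ((m : ℝ)⁻¹ • ∑ i ∈ Finset.range m, u (X i a) - ∫ x, u x ∂μ) = empProc μ X m u a := by
  have hm' : (0 : ℝ) < m := by exact_mod_cast hm
  have hs : (√(m : ℝ))⁻¹ = √(m : ℝ) * (m : ℝ)⁻¹ := by
    nth_rewrite 3 [← Real.mul_self_sqrt hm'.le]
    field_simp
  rw [empProc, Finset.sum_sub_distrib, Finset.sum_const, Finset.card_range, hs, mul_smul]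
  congr 1
  rw [smul_sub, ← Nat.cast_smul_eq_nsmul ℝ, smul_smul (m : ℝ)⁻¹, inv_mul_cancel₀ hm'.ne', one_smul]

/-- The prediction terms cancel because the unlabeled law is the marginal `π.snd`; hence the centre
of the estimating equation does not depend on the weights. -/
lemma integral_labScore_add_integral_unlScore {d q : ℕ} {𝒵 : Type*} [MeasurableSpace 𝒵]
    {π : Measure (ℝ × Vec d × 𝒵)} {ψ : ℝ → Vec d → Vec q → Vec q} {f : 𝒵 → ℝ} {w : Fin q → ℝ}
    (hψ : ∀ θ, Measurable (fun p : ℝ × Vec d => ψ p.1 p.2 θ)) (hf : Measurable f) {θ : Vec q}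
    (h1 : Integrable (trueScore ψ θ) π) (h2 : Integrable (fun p => unlScore ψ f w θ p.2) π) :
    ∫ p, labScore ψ f w θ p ∂π + ∫ u, unlScore ψ f w θ u ∂π.snd = ∫ p, trueScore ψ θ p ∂π := by
  rw [integral_snd (measurable_unlScore hψ hf θ)]
  change ∫ p, (trueScore ψ θ p - unlScore ψ f w θ p.2) ∂π + _ = _
  rw [integral_sub h1 h2, sub_add_cancel]

variable {d q : ℕ} {𝒵 Ω : Type*} [MeasurableSpace 𝒵] [MeasurableSpace Ω]
  {P : Measure Ω} [IsProbabilityMeasure P] {π : Measure (ℝ × Vec d × 𝒵)} [IsProbabilityMeasure π]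
  {ψ : ℝ → Vec d → Vec q → Vec q} {f : 𝒵 → ℝ} {w : Fin q → ℝ} {Θ : Set (Vec q)} {θ₀ : Vec q}
  {n N : ℕ → ℕ} {L : ℕ → Ω → ℝ × Vec d × 𝒵} {U : ℕ → Ω → Vec d × 𝒵} {est : ℕ → Ω → Vec q}

/-- **Consistency** of the estimator. -/
theorem tendstoInMeasure_est (hψ : ∀ θ, Measurable (fun p : ℝ × Vec d => ψ p.1 p.2 θ))
    (hf : Measurable f) (hn : Tendsto n atTop atTop) (hN : Tendsto N atTop atTop)
    (C1 : CondC1 ψ π Θ θ₀) (C2 : CondC2 P ψ f w π Θ n N L U) (C3 : CondC3 ψ f w π Θ)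
    (C4 : CondC4 P π L U)
    (est_solves : ∀ k, ∀ᵐ a ∂P,
      (∃! θ, IsSolution ψ f w Θ (n k) (N k) (fun i => L i a) (fun j => U j a) θ) →
        IsSolution ψ f w Θ (n k) (N k) (fun i => L i a) (fun j => U j a) (est k a)) :
    TendstoInMeasure P est atTop (fun _ => θ₀) := by
  obtain ⟨h, hh, hhΘ⟩ := C3.envelope
  have hunl : ∀ θ, Measurable (unlScore ψ f w θ) := measurable_unlScore hψ hf
  have hlab : ∀ θ, Measurable (labScore ψ f w θ) := measurable_labScore hψ hf
  have hti : ∀ θ ∈ Θ, Integrable (trueScore ψ θ) π := fun θ hθ =>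
    hh.mono' (measurable_trueScore hψ θ).aestronglyMeasurable
      (hhΘ.mono fun p hp => (hp θ hθ).1)
  have hui : ∀ θ ∈ Θ, Integrable (fun p : ℝ × Vec d × 𝒵 => unlScore ψ f w θ p.2) π := fun θ hθ =>
    hh.mono' ((hunl θ).comp measurable_snd).aestronglyMeasurable
      (hhΘ.mono fun p hp => (hp θ hθ).2)
  -- The given envelope may depend on Y, which unlabeled points lack.
  obtain ⟨h', hh', hh'Θ⟩ := exists_integrable_majorant_snd hh
    (R := fun u c => ∀ θ ∈ Θ, ‖unlScore ψ f w θ u‖ ≤ c)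
    (fun u c c' hcc H θ hθ => (H θ hθ).trans hcc) (hhΘ.mono fun p hp θ hθ => (hp θ hθ).2)
  have : IsProbabilityMeasure π.snd := inferInstance
  obtain ⟨D₁, hD₁, hD₁Θ⟩ := uniform_law_of_large_numbers C4.measurable_labeled C4.law_labeled
    C4.indep_labeled C1.compact hlab
    (by filter_upwards [C2.continuous_true, C2.continuous_pred] with p h1 h2 using h1.sub h2)
    (hh.const_mul 2)
    (by
      filter_upwards [hhΘ] with p hp θ hθ
      refine (norm_sub_le _ _).trans ?_
      linarith [(hp θ hθ).1, (hp θ hθ).2])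
  obtain ⟨D₂, hD₂, hD₂Θ⟩ := uniform_law_of_large_numbers C4.measurable_unlabeled C4.law_unlabeled
    C4.indep_unlabeled C1.compact hunl
    (ae_snd_of_ae (R := fun u => ContinuousOn (fun θ => unlScore ψ f w θ u) Θ) C2.continuous_pred)
    hh' hh'Θ
  refine tendstoInMeasure_of_uniform
    (Ψ := fun k a θ => estFun ψ f w (n k) (N k) (fun i => L i a) (fun j => U j a) θ)
    (m := fun θ => ∫ p, trueScore ψ θ p ∂π) C1.compact ?_ C1.unique
    (tendstoInMeasure_zero_add (hD₁.comp hn) (hD₂.comp hN)) ?_ C2.unique_solution ?_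
  · exact continuousOn_of_dominated
      (fun θ _ => (measurable_trueScore hψ θ).aestronglyMeasurable)
      (fun θ hθ => hhΘ.mono fun p hp => (hp θ hθ).1) hh C2.continuous_true
  · intro k
    filter_upwards [hD₁Θ, hD₂Θ] with a h1 h2 θ hθ
    rw [estFun_eq, ← integral_labScore_add_integral_unlScore hψ hf (hti θ hθ) (hui θ hθ),
      add_sub_add_comm]
    exact (norm_add_le _ _).trans (add_le_add (h1 (n k) θ hθ) (h2 (N k) θ hθ))
  · intro k
    filter_upwards [est_solves k] with a ha hab
    exact ha (not_not.1 hab)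

/-- **Asymptotic linearity** of the estimator. -/
theorem tendstoInMeasure_linearization
    (hψ : ∀ θ, Measurable (fun p : ℝ × Vec d => ψ p.1 p.2 θ))
    (hf : Measurable f) (hn : Tendsto n atTop atTop) (hN : Tendsto N atTop atTop)
    (C1 : CondC1 ψ π Θ θ₀) (C2 : CondC2 P ψ f w π Θ n N L U)
    (h1 : MemLp (trueScore ψ θ₀) 2 π) (h2 : MemLp (fun p => unlScore ψ f w θ₀ p.2) 2 π)
    (C4 : CondC4 P π L U)
    (est_solves : ∀ k, ∀ᵐ a ∂P,
      (∃! θ, IsSolution ψ f w Θ (n k) (N k) (fun i => L i a) (fun j => U j a) θ) →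
        IsSolution ψ f w Θ (n k) (N k) (fun i => L i a) (fun j => U j a) (est k a))
    (hcons : TendstoInMeasure P est atTop (fun _ => θ₀)) {c₀ : ℝ}
    (hc : Tendsto (fun k => √((n k : ℝ) / (N k : ℝ))) atTop (𝓝 c₀))
    {A : Matrix (Fin q) (Fin q) ℝ} (C5 : CondC5 ψ f w π θ₀ A) :
    TendstoInMeasure P (fun k a => √(n k : ℝ) • (est k a - θ₀) +
      Matrix.toEuclideanCLM (𝕜 := ℝ) A⁻¹ (empProc π L (n k) (labScore ψ f w θ₀) a +
        √((n k : ℝ) / (N k : ℝ)) • empProc π.snd U (N k) (unlScore ψ f w θ₀) a)) atTop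
      fun _ => 0 := by
  obtain ⟨φ, hφ, r, hr, hLip⟩ := C5.lipschitz
  have hunl : ∀ θ, Measurable (unlScore ψ f w θ) := measurable_unlScore hψ hf
  have hlab : ∀ θ, Measurable (labScore ψ f w θ) := measurable_labScore hψ hf
  have : IsProbabilityMeasure π.snd := inferInstance
  have hLipT : ∀ᵐ p ∂π, ∀ s ∈ Metric.ball θ₀ r, ∀ t ∈ Metric.ball θ₀ r,
      ‖trueScore ψ s p - trueScore ψ t p‖ ≤ φ p * ‖s - t‖ :=
    hLip.mono fun p hp s hs t ht => (hp s hs t ht).1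
  have hLipU : ∀ᵐ p ∂π, ∀ s ∈ Metric.ball θ₀ r, ∀ t ∈ Metric.ball θ₀ r,
      ‖unlScore ψ f w s p.2 - unlScore ψ f w t p.2‖ ≤ φ p * ‖s - t‖ := by
    filter_upwards [hLip] with p hp s hs t ht
    have := (hp s hs t ht).2
    simpa only [unlScore, ← diagCLM_apply, map_sub] using this
  -- Lipschitz factors that are measurable and nonnegative
  obtain ⟨φ₁, hφ₁m, hφ₁0, hφ₁, hφ₁le⟩ : ∃ φ₁ : ℝ × Vec d × 𝒵 → ℝ, Measurable φ₁ ∧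
      (∀ p, 0 ≤ φ₁ p) ∧ MemLp φ₁ 2 π ∧ ∀ᵐ p ∂π, φ p ≤ φ₁ p := by
    refine ⟨fun p => |hφ.1.mk φ p|, hφ.1.stronglyMeasurable_mk.measurable.abs,
      fun p => abs_nonneg _, (hφ.ae_eq hφ.1.ae_eq_mk).abs, ?_⟩
    filter_upwards [hφ.1.ae_eq_mk] with p hp
    rw [← hp]
    exact le_abs_self _
  obtain ⟨φ₂, hφ₂m, hφ₂0, hφ₂, hLip₂⟩ := exists_memLp_two_majorant_snd hφ
    (R := fun u c => ∀ s ∈ Metric.ball θ₀ r, ∀ t ∈ Metric.ball θ₀ r,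
      ‖unlScore ψ f w s u - unlScore ψ f w t u‖ ≤ c * ‖s - t‖)
    (fun u c c' hcc H s hs t ht => (H s hs t ht).trans (by gcongr)) hLipU
  have hLip₁ : ∀ᵐ p ∂π, ∀ s ∈ Metric.ball θ₀ r, ∀ t ∈ Metric.ball θ₀ r,
      ‖labScore ψ f w s p - labScore ψ f w t p‖ ≤ (2 * φ₁ p) * ‖s - t‖ := by
    filter_upwards [hLipT, hLipU, hφ₁le] with p hp1 hp2 hp s hs t ht
    calc ‖labScore ψ f w s p - labScore ψ f w t p‖
        = ‖(trueScore ψ s p - trueScore ψ t p) -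
            (unlScore ψ f w s p.2 - unlScore ψ f w t p.2)‖ := by
          congr 1
          simp only [labScore, unlScore]
          abel
      _ ≤ φ p * ‖s - t‖ + φ p * ‖s - t‖ :=
          (norm_sub_le _ _).trans (add_le_add (hp1 s hs t ht) (hp2 s hs t ht))
      _ ≤ _ := by
          have := mul_le_mul_of_nonneg_right hp (norm_nonneg (s - t))
          linarith
  have hl2 : MemLp (labScore ψ f w θ₀) 2 π := h1.sub h2
  have hu2 : MemLp (unlScore ψ f w θ₀) 2 π.snd := memLp_two_snd (hunl θ₀) h2
  have hli : Integrable (labScore ψ f w θ₀) π := hl2.integrable (by norm_num)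
  have hui : Integrable (unlScore ψ f w θ₀) π.snd := hu2.integrable (by norm_num)
  obtain ⟨K₁, hK₁0, hK₁⟩ := stochastic_equicontinuity C4.measurable_labeled C4.law_labeled
    C4.indep_labeled hlab (hφ₁m.const_mul 2) (fun p => mul_nonneg zero_le_two (hφ₁0 p))
    (hφ₁.const_mul 2) hLip₁ hli
  obtain ⟨K₂, hK₂0, hK₂⟩ := stochastic_equicontinuity C4.measurable_unlabeled C4.law_unlabeled
    C4.indep_unlabeled hunl hφ₂m hφ₂0 hφ₂ hLip₂ hui
  obtain ⟨W₁, hW₁0, hW₁⟩ := exists_lintegral_enorm_empProc_le C4.measurable_labeled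
    C4.law_labeled C4.indep_labeled (hlab θ₀) hl2 hli
  obtain ⟨W₂, hW₂0, hW₂⟩ := exists_lintegral_enorm_empProc_le C4.measurable_unlabeled
    C4.law_unlabeled C4.indep_unlabeled (hunl θ₀) hu2 hui
  set c : ℕ → ℝ := fun k => √((n k : ℝ) / (N k : ℝ)) with hc_def
  have hc0 : ∀ k, 0 ≤ c k := fun k => Real.sqrt_nonneg _
  have hc₀ : 0 ≤ c₀ := ge_of_tendsto' hc hc0
  have hcle : ∀ᶠ k in atTop, c k ≤ c₀ + 1 :=
    hc.eventually_le_const (by linarith)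
  have henorm : ∀ k, c k ≤ c₀ + 1 → ∀ v : Vec q, ‖c k • v‖ₑ ≤ ENNReal.ofReal (c₀ + 1) * ‖v‖ₑ := by
    intro k hk v
    rw [enorm_smul, Real.enorm_of_nonneg (hc0 k)]
    gcongr
  have hm1 : ∀ k, Measurable (empProc π L (n k) (labScore ψ f w θ₀)) := fun k =>
    measurable_empProc C4.measurable_labeled (hlab θ₀)
  have hm2 : ∀ k, Measurable (empProc π.snd U (N k) (unlScore ψ f w θ₀)) := fun k =>
    measurable_empProc C4.measurable_unlabeled (hunl θ₀)
  refine asymptotic_linearity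
    (Ψ := fun k a θ => estFun ψ f w (n k) (N k) (fun i => L i a) (fun j => U j a) θ)
    (m := fun θ => ∫ p, trueScore ψ θ p ∂π)
    (A := Matrix.toEuclideanCLM (𝕜 := ℝ) A) (s := fun k => √(n k : ℝ))
    (W := fun k a => empProc π L (n k) (labScore ψ f w θ₀) a +
      c k • empProc π.snd U (N k) (unlScore ψ f w θ₀) a)
    -- The factor √(n/N) is eventually at most c₀ + 1. The radius is r/2 because equicontinuity on a
    -- δ-ball needs 2δ < r.
    (C₁ := W₁ + (c₀ + 1) * W₂) (C₂ := K₁ + (c₀ + 1) * K₂) (δ₀ := r / 2)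
    ?_ C5.differentiable C1.solves (fun k => Real.sqrt_nonneg _) (by positivity) ?_ ?_
    (by positivity) (by positivity) ?_ C2.unique_solution ?_ hcons
  · intro t
    rw [← mul_apply_eq_comp, ← map_mul, Matrix.nonsing_inv_mul A C5.nonsingular, map_one]
    rfl
  · exact fun k => ((hm1 k).add (Measurable.fun_const_smul (hm2 k) (c k))).enorm.aemeasurable
  · filter_upwards [hcle] with k hk
    calc _ ≤ ∫⁻ a, (‖empProc π L (n k) (labScore ψ f w θ₀) a‖ₑ + ENNReal.ofReal (c₀ + 1) *
          ‖empProc π.snd U (N k) (unlScore ψ f w θ₀) a‖ₑ) ∂P :=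
          lintegral_mono fun a => (enorm_add_le _ _).trans (add_le_add le_rfl (henorm k hk _))
      _ ≤ ENNReal.ofReal W₁ + ENNReal.ofReal (c₀ + 1) * ENNReal.ofReal W₂ := by
          rw [lintegral_add_left (hm1 k).enorm, lintegral_const_mul _ (hm2 k).enorm]
          gcongr
          · exact hW₁ _
          · exact hW₂ _
      _ = _ := by
          rw [← ENNReal.ofReal_mul (by positivity), ← ENNReal.ofReal_add hW₁0 (by positivity)]
  · intro δ hδ hδr
    filter_upwards [hcle, hn.eventually_gt_atTop 0, hN.eventually_gt_atTop 0] with k hk hnk hNk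
    obtain ⟨D₁, hD₁m, hD₁i, hD₁⟩ := hK₁ δ hδ (by linarith) (n k) hnk
    obtain ⟨D₂, hD₂m, hD₂i, hD₂⟩ := hK₂ δ hδ (by linarith) (N k) hNk
    refine ⟨fun a => D₁ a + ENNReal.ofReal (c₀ + 1) * D₂ a, hD₁m.add (hD₂m.const_mul _), ?_, ?_⟩
    · rw [lintegral_add_left hD₁m, lintegral_const_mul _ hD₂m, add_mul, mul_assoc,
        ENNReal.ofReal_add (mul_nonneg hK₁0 hδ.le) (by positivity),
        ENNReal.ofReal_mul (p := c₀ + 1) (by positivity)]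
      gcongr
    · filter_upwards [hD₁, hD₂] with a ha1 ha2 t ht
      have htr : t ∈ Metric.ball θ₀ r := Metric.closedBall_subset_ball (by linarith) ht
      have hθr : θ₀ ∈ Metric.ball θ₀ r := Metric.mem_ball_self hr
      have hφi : Integrable φ π := hφ.integrable (by norm_num)
      -- The ball around θ₀ may leave Θ, where the envelope is unavailable; integrability comes from
      -- the Lipschitz bound instead.
      have hti : Integrable (trueScore ψ t) π :=
        integrable_of_lipschitz hφi (measurable_trueScore hψ t).aestronglyMeasurable
          (h1.integrable (by norm_num)) (hLipT.mono fun p hp => hp t htr θ₀ hθr)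
      have huti : Integrable (fun p : ℝ × Vec d × 𝒵 => unlScore ψ f w t p.2) π :=
        integrable_of_lipschitz (g := fun t (p : ℝ × Vec d × 𝒵) => unlScore ψ f w t p.2) hφi
          ((hunl t).comp measurable_snd).aestronglyMeasurable
          (h2.integrable (by norm_num)) (hLipU.mono fun p hp => hp t htr θ₀ hθr)
      -- Converts the common scaling √n into the unlabeled sample's own scaling √N.
      have hck : √(n k : ℝ) = c k * √(N k : ℝ) := by
        have : (0 : ℝ) < N k := by exact_mod_cast hNk
        simp only [hc_def]
        rw [← Real.sqrt_mul (by positivity), div_mul_cancel₀ _ this.ne']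
      have hdecomp : √(n k : ℝ) • (estFun ψ f w (n k) (N k) (fun i => L i a) (fun j => U j a) t -
            ∫ p, trueScore ψ t p ∂π) =
          empProc π L (n k) (labScore ψ f w t) a +
            c k • empProc π.snd U (N k) (unlScore ψ f w t) a := by
        rw [estFun_eq, ← integral_labScore_add_integral_unlScore hψ hf hti huti, add_sub_add_comm,
          smul_add, smul_mean_sub_eq_empProc hnk, hck, mul_smul, smul_mean_sub_eq_empProc hNk]
      rw [hdecomp, add_sub_add_comm, ← smul_sub]
      exact (enorm_add_le _ _).trans
        (add_le_add (ha1 t ht) ((henorm k hk _).trans (mul_le_mul_right (ha2 t ht) _)))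
  · intro k
    filter_upwards [est_solves k] with a ha hab
    exact (ha (not_not.1 hab)).2

/-- **Asymptotic normality** of the estimator. -/
theorem tendstoInDistribution_est
    (hψ : ∀ θ, Measurable (fun p : ℝ × Vec d => ψ p.1 p.2 θ))
    (hf : Measurable f) (hn : Tendsto n atTop atTop) (hN : Tendsto N atTop atTop)
    (C1 : CondC1 ψ π Θ θ₀) (C2 : CondC2 P ψ f w π Θ n N L U)
    (h1 : MemLp (trueScore ψ θ₀) 2 π) (h2 : MemLp (fun p => unlScore ψ f w θ₀ p.2) 2 π)
    (C4 : CondC4 P π L U) (est_meas : ∀ k, AEMeasurable (est k) P)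
    (est_solves : ∀ k, ∀ᵐ a ∂P,
      (∃! θ, IsSolution ψ f w Θ (n k) (N k) (fun i => L i a) (fun j => U j a) θ) →
        IsSolution ψ f w Θ (n k) (N k) (fun i => L i a) (fun j => U j a) (est k a))
    (hcons : TendstoInMeasure P est atTop (fun _ => θ₀)) {ρ : ℝ} (hρ : 0 ≤ ρ)
    (hlim : Tendsto (fun k => (n k : ℝ) / (N k : ℝ)) atTop (𝓝 ρ))
    {A : Matrix (Fin q) (Fin q) ℝ} (C5 : CondC5 ψ f w π θ₀ A) :
    TendstoInDistribution (fun k a => √(n k : ℝ) • (est k a - θ₀)) atTop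
      (id : Vec q → Vec q) (fun _ => P) (multivariateGaussian 0 (asympCov ψ f w π θ₀ ρ A)) := by
  have hc : Tendsto (fun k => √((n k : ℝ) / (N k : ℝ))) atTop (𝓝 √ρ) := hlim.sqrt
  have hunl : Measurable (unlScore ψ f w θ₀) := measurable_unlScore hψ hf θ₀
  have hlab : Measurable (labScore ψ f w θ₀) := measurable_labScore hψ hf θ₀
  have : IsProbabilityMeasure π.snd := inferInstance
  have hl2 : MemLp (labScore ψ f w θ₀) 2 π := h1.sub h2
  have hu2 : MemLp (unlScore ψ f w θ₀) 2 π.snd := memLp_two_snd hunl h2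
  set A' : Vec q →L[ℝ] Vec q := -Matrix.toEuclideanCLM (𝕜 := ℝ) A⁻¹ with hA'
  have hclt := tendstoInDistribution_empProc_add C4.measurable_labeled C4.law_labeled
    C4.indep_labeled C4.measurable_unlabeled C4.law_unlabeled C4.indep_unlabeled C4.indep
    (u := fun p => A' (labScore ψ f w θ₀ p)) (A'.continuous.measurable.comp hlab)
    (hl2.continuousLinearMap_comp A') (v := fun u => A' (unlScore ψ f w θ₀ u))
    (A'.continuous.measurable.comp hunl) (hu2.continuousLinearMap_comp A') hn hN hc
    (posSemidef_asympCov A (posSemidef_V hψ hf hρ h1 h2))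
    (fun t => by
      rw [dotProduct_asympCov_mulVec hψ hf ρ h1 h2 A t, Real.sq_sqrt hρ]
      rfl)
  -- Slutsky: the scaled error differs from -A⁻¹W by a term vanishing in probability.
  refine tendstoInDistribution_of_tendstoInMeasure_sub _ _ hclt ?_
    fun k => ((est_meas k).sub_const θ₀).fun_const_smul _
  refine (tendstoInMeasure_linearization hψ hf hn hN C1 C2 h1 h2 C4 est_solves hcons hc
    C5).congr_left fun k => ae_of_all _ fun a => ?_
  rw [Pi.sub_apply, Pi.sub_apply, empProc_clm A' (hl2.integrable (by norm_num)),
    empProc_clm A' (hu2.integrable (by norm_num)), ← map_smul, ← map_add, hA',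
    neg_apply, sub_neg_eq_add]

end main

end PSPA

end

theorem theorem1 {d q : ℕ} {𝒵 Ω : Type*} [MeasurableSpace 𝒵] [MeasurableSpace Ω]
    (P : Measure Ω) [IsProbabilityMeasure P]
    (π : Measure (ℝ × PSPA.Vec d × 𝒵)) [IsProbabilityMeasure π]
    (ψ : ℝ → PSPA.Vec d → PSPA.Vec q → PSPA.Vec q)
    (hψ : ∀ θ, Measurable (fun p : ℝ × PSPA.Vec d => ψ p.1 p.2 θ))
    (f : 𝒵 → ℝ) (hf : Measurable f)
    (w : Fin q → ℝ)
    (Θ : Set (PSPA.Vec q)) (θ₀ : PSPA.Vec q)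
    (n N : ℕ → ℕ) (hn : Tendsto n atTop atTop) (hN : Tendsto N atTop atTop)
    (L : ℕ → Ω → ℝ × PSPA.Vec d × 𝒵) (U : ℕ → Ω → PSPA.Vec d × 𝒵)
    (C1 : PSPA.CondC1 ψ π Θ θ₀)
    (C2 : PSPA.CondC2 P ψ f w π Θ n N L U)
    (C3 : PSPA.CondC3 ψ f w π Θ)
    (C4 : PSPA.CondC4 P π L U)
    (est : ℕ → Ω → PSPA.Vec q) (est_meas : ∀ k, AEMeasurable (est k) P)
    (est_solves : ∀ k, ∀ᵐ a ∂P,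
      (∃! θ, PSPA.IsSolution ψ f w Θ (n k) (N k) (fun i => L i a) (fun j => U j a) θ) →
        PSPA.IsSolution ψ f w Θ (n k) (N k) (fun i => L i a) (fun j => U j a) (est k a)) :
    TendstoInMeasure P est atTop (fun _ => θ₀) ∧
    ∀ ρ : ℝ, Tendsto (fun k => (n k : ℝ) / (N k : ℝ)) atTop (𝓝 ρ) →
    ∀ A : Matrix (Fin q) (Fin q) ℝ, PSPA.CondC5 ψ f w π θ₀ A →
      (PSPA.asympCov ψ f w π θ₀ ρ A).PosSemidef ∧
      TendstoInDistribution (fun k a => √(n k : ℝ) • (est k a - θ₀)) atTop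
        (id : PSPA.Vec q → PSPA.Vec q) (fun _ => P)
        (multivariateGaussian 0 (PSPA.asympCov ψ f w π θ₀ ρ A)) ∧
      ((∀ᵐ p ∂π, DifferentiableAt ℝ (ψ p.1 p.2.1) θ₀) →
        Integrable (fun p => fderiv ℝ (ψ p.1 p.2.1) θ₀) π ∧
        ∀ i j, A i j = ∫ p, (fderiv ℝ (ψ p.1 p.2.1) θ₀ (EuclideanSpace.single j 1)) i ∂π) := by
  have hcons := PSPA.tendstoInMeasure_est hψ hf hn hN C1 C2 C3 C4 est_solves
  have h1 : MemLp (PSPA.trueScore ψ θ₀) 2 π := PSPA.memLp_two_of_iSup C3.moment_true C1.mem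
    (PSPA.measurable_trueScore hψ θ₀).aestronglyMeasurable
  have h2 : MemLp (fun p => PSPA.unlScore ψ f w θ₀ p.2) 2 π :=
    PSPA.memLp_two_of_iSup (g := fun θ (p : ℝ × PSPA.Vec d × 𝒵) => PSPA.unlScore ψ f w θ p.2)
      C3.moment_pred C1.mem
      ((PSPA.measurable_unlScore hψ hf θ₀).comp measurable_snd).aestronglyMeasurable
  refine ⟨hcons, fun ρ hlim A C5 => ?_⟩
  have hρ : 0 ≤ ρ := ge_of_tendsto' hlim fun k => by positivity
  refine ⟨PSPA.posSemidef_asympCov A (PSPA.posSemidef_V hψ hf hρ h1 h2),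
    PSPA.tendstoInDistribution_est hψ hf hn hN C1 C2 h1 h2 C4 est_meas est_solves hcons hρ hlim C5,
    fun hd => ?_⟩
  obtain ⟨φ, hφ, r, hr, hLip⟩ := C5.lipschitz
  obtain ⟨hint, hder⟩ := PSPA.fderiv_integral_of_lipschitz (μ := π) (g := PSPA.trueScore ψ)
    (fun θ => (PSPA.measurable_trueScore hψ θ).aestronglyMeasurable) hr
    (h1.integrable (by norm_num)) (hφ.integrable (by norm_num))
    (hLip.mono fun p hp t ht => (hp t ht θ₀ (Metric.mem_ball_self hr)).1) hd
  refine ⟨hint, fun i j => ?_⟩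
  -- Both `A` and the mean of the pointwise derivatives are derivatives of E ψ(Y,X;·) at θ₀, so they
  -- coincide; compare entries.
  have heq := congrArg (fun T : PSPA.Vec q →L[ℝ] PSPA.Vec q => T (EuclideanSpace.single j 1) i)
    (C5.differentiable.unique hder)
  have hij : Matrix.toEuclideanCLM (n := Fin q) (𝕜 := ℝ) A (EuclideanSpace.single j 1) i = A i j := by
    simp
  rw [← hij]
  refine heq.trans ?_
  simp only []
  rw [ContinuousLinearMap.integral_apply hint]
  exact ((EuclideanSpace.proj (𝕜 := ℝ) i).integral_comp_comm
    (hint.apply_continuousLinearMap _)).symm
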